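/- **Setting.** Let $N\ge 0$, $k\ge 1$, $\gamma>0$, $\beta\in(0,\infty]$. A partition $\mathcal I$ of $\{1,\dots,N\}$ is a partition into discrete intervals. For data $f\in\mathbb R^N$ consider the higher order Mumford–Shah problem ($\beta<\infty$) $$\min_{u\in\mathbb R^N,\ \mathcal I}\ \|u-f\|_2^2+\sum_{I\in\mathcal I}\beta^{2k}\|\nabla^k u_I\|_2^2+\gamma|\mathcal I| ,$$ where $\nabla^k$ is the $k$-th finite difference (the term is absent if $|I|\le k$), and the higher order Potts problem ($\beta=\infty$), in which the smoothness term is replaced by the constraint that each $u_I$ is a polynomial of degree at most $k-1$. For one interval $I$ and data $x$ on $I$, let $S_I x$ be the minimizer and $\mathcal E^I(x)$ the minimum of $\|v-x\|_2^2+\beta^{2k}\|\nabla^k v\|_2^2$ (for $\beta=\infty$: of $\|v-x\|_2^2$ over polynomials $v$ of degree at most $k-1$). Two partitions are equivalent if they have the same intervals of length at least $k+1$; $|[\mathcal I]|$ is the least cardinality in the class of $\mathcal I$, and $\mathcal G_{\mathcal I}(f)=\sum_{I\in\mathcal I}\mathcal E^I(f_I)+\gamma|[\mathcal I]|$. **Algorithm.**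 Let $0\le\tau<1$. In an arithmetic of precision $\tau$ the computed value of each operation $+,-,\times,/,\sqrt{\ }$ is the exact one times $1+e$ with $|e|\le\tau$. In such an arithmetic, the row-wise Givens QR algorithm applied to the least squares problem on $I$ gives a computed error $\tilde{\mathcal E}^I$ (accumulated residual) and a computed fit $\tilde S_I$ (back substitution; for $\beta=\infty$ the polynomial with the computed coefficients; if $|I|\le k$, the data itself). The proposed algorithm runs, on the values $\tilde{\mathcal E}^{l:r}(f_{l:r})$, the dynamic program $$P_r=\min\Big\{\tilde{\mathcal E}^{1:r},\ \min_{2\le l\le r}\big(P_{l-1}+\gamma+\tilde{\mathcal E}^{l:r}\big)\Big\}$$ with two pruning rules: $l$ runs downwards and the search at $r$ stops once $\tilde{\mathcal E}^{l:r}+\gamma$ exceeds the current value $P_r$; and $l$ is deleted permanently once $P_{l-1}+\tilde{\mathcal E}^{l:s}\ge P_s$ (current value of $P_s$) for some $s>l$ to which $\tilde{\mathcal E}^{l:s}$ has been updated. The sums and comparisons of the dynamic program on the computed errors are carried out exactly. The minimizing partition is then read off, and the output $\tilde u_f$ consists of the computed fits $\tilde S_I(f_I)$ on its intervals $I$. Put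 $\tilde{\mathcal G}_{\mathcal I}(f)=\sum_{I\in\mathcal I}\tilde{\mathcal E}^I(f_I)+\gamma|[\mathcal I]|$. **Error quantities.** Let $C>0$. - $\mu_{I}(\tau)\in[0,\infty]$ is the infimum of all $m$ such that for every arithmetic of precision $\tau$ and all data $x$ on $I$ there is $y$ with $\tilde S_I x=S_I y$ and $\|y-x\|\le m\|x\|$. Put $\delta_I(\tau)=C\mu_I(\tau)$, $\delta_{\mathcal I}(\tau)=\big(\sum_{I\in\mathcal I}\delta_I(\tau)^2\big)^{1/2}$ and $\delta^*(\tau)=\max_{\mathcal I}\delta_{\mathcal I}(\tau)$. - $g(\tau)$ is the supremum of $|\tilde{\mathcal G}_{\mathcal I}(x)-\mathcal G_{\mathcal I}(x)|$ over all arithmetics of precision $\tau$, all $x\in\mathbb R^N$ with $\|x\|<C$ and all partitions $\mathcal I$. **Statement.** Let $f\in\mathbb R^N$ with $\|f\|<C$. Assume that there are $\varepsilon>0$ and a partition $\mathcal I'$ such that $\mathcal G_{\mathcal I'}(f)<\mathcal G_{\mathcal I}(f)-\varepsilon$ for all partitions $\mathcal I$ not equivalent to $\mathcal I'$. Let $$\delta=\min\Big(\frac{\varepsilon}{2\,(2\beta)^{2k}\,(\|f\|+1/2)},\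 \frac12\Big),$$ with $(2\beta)^{2k}$ replaced by $1$ if $\beta=\infty$, and assume that $\delta^*(\tau)<\delta/2$ and $g(\tau)\le\varepsilon/4$. Then the problem with data $f$ has a unique minimizing signal $u_f$. Moreover, in every arithmetic of precision $\tau$ the algorithm is backward stable: there is $\tilde f\in\mathbb R^N$ such that $$\tilde u_f=u_{\tilde f},\qquad \|\tilde f-f\|<\delta^*(\tau)$$ (in the degenerate case $\delta^*(\tau)=0$: $\tilde f=f$), where $u_{\tilde f}$ is the unique minimizing signal of the problem with data $\tilde f$. -/

import Mathlib

noncomputable section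

open scoped ENNReal

namespace MumfordShah

/-! ### Signals, segments and partitions into intervals

A signal of length `n` is a vector of `EuclideanSpace ℝ (Fin n)`. The pair `(a, b)` with `a < b`
stands for the discrete interval `{a + 1, …, b}` of `{1, …, N}`; in zero-based indexing its
entries are `a, …, b - 1` and its length is `b - a`. -/

/-- Extension of a finite signal by zero to all of `ℕ`. -/
def extend {n : ℕ} (v : EuclideanSpace ℝ (Fin n)) (i : ℕ) : ℝ :=
  if h : i < n then v ⟨i, h⟩ else 0

/-- Restriction of the signal `f` to the interval `(a, b)`. -/
def segment {N : ℕ} (f : EuclideanSpace ℝ (Fin N)) (a b : ℕ) : EuclideanSpace ℝ (Fin (b - a)) :=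
  WithLp.toLp 2 fun i => extend f (a + i)

/-- A partition of the domain `{1, …, N}` into discrete intervals. -/
structure IntervalPartition (N : ℕ) where
  parts : Finset (ℕ × ℕ)
  valid : ∀ p ∈ parts, p.1 < p.2 ∧ p.2 ≤ N
  cover : ∀ n, n < N → ∃! p, p ∈ parts ∧ p.1 ≤ n ∧ n < p.2

namespace IntervalPartition

variable {N : ℕ}

/-- Number of intervals of the partition. -/
def size (I : IntervalPartition N) : ℕ := I.parts.card

/-- The intervals of length at least `k + 1`. -/
def longParts (k : ℕ) (I : IntervalPartition N) : Finset (ℕ × ℕ) :=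
  I.parts.filter fun p => k < p.2 - p.1

/-- Two partitions are equivalent if they have the same intervals of length at least `k + 1`. -/
def Equivalent (k : ℕ) (I J : IntervalPartition N) : Prop := I.longParts k = J.longParts k

/-- The least number of intervals of a partition in the equivalence class of `I`. -/
def classSize (k : ℕ) (I : IntervalPartition N) : ℕ :=
  sInf {m | ∃ J : IntervalPartition N, Equivalent k J I ∧ J.size = m}

end IntervalPartition

/-! ### The higher order Mumford-Shah (`β < ∞`) and Potts (`β = ∞`) problems -/

/-- `v` is given by a polynomial of degree at most `k - 1`. -/
def IsPolynomialSignal (k : ℕ) {n : ℕ} (v : EuclideanSpace ℝ (Fin n)) : Prop :=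
  ∃ p ∈ Polynomial.degreeLT ℝ k, ∀ i : Fin n, v i = p.eval ((i : ℝ) + 1)

/-- The constraint on one segment: for `β = ∞` the signal has to be a polynomial of degree
at most `k - 1`; for `β < ∞` there is no constraint. -/
def SegmentAdmissible (k : ℕ) (β : ℝ≥0∞) {n : ℕ} (v : EuclideanSpace ℝ (Fin n)) : Prop :=
  β = ⊤ → IsPolynomialSignal k v

/-- Smoothness penalty `β ^ (2k) ‖∇ᵏ v‖²` of one segment (empty sum if the length is at most `k`);
for `β = ∞` it is replaced by the constraint `SegmentAdmissible`. -/
def smoothness (k : ℕ) (β : ℝ≥0∞) {n : ℕ} (v : EuclideanSpace ℝ (Fin n)) : ℝ :=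
  if β = ⊤ then 0
  else β.toReal ^ (2 * k) * ∑ i ∈ Finset.range (n - k), ((fwdDiff 1)^[k] (extend v) i) ^ 2

/-- Constraint on a signal `u` for the partition `I`. -/
def Admissible (k : ℕ) (β : ℝ≥0∞) {N : ℕ} (u : EuclideanSpace ℝ (Fin N))
    (I : IntervalPartition N) : Prop :=
  ∀ p ∈ I.parts, SegmentAdmissible k β (segment u p.1 p.2)

/-- The functional `‖u - f‖² + ∑_{I} β ^ (2k) ‖∇ᵏ u_I‖² + γ |𝓘|`. -/
def energy (k : ℕ) (β : ℝ≥0∞) (γ : ℝ) {N : ℕ} (f u : EuclideanSpace ℝ (Fin N))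
    (I : IntervalPartition N) : ℝ :=
  ‖u - f‖ ^ 2 + ∑ p ∈ I.parts, smoothness k β (segment u p.1 p.2) + γ * I.size

/-- `u` is (the signal part of) a minimizer of the problem for the data `f`. -/
def IsMinimizer (k : ℕ) (β : ℝ≥0∞) (γ : ℝ) {N : ℕ} (f u : EuclideanSpace ℝ (Fin N)) : Prop :=
  ∃ I : IntervalPartition N, Admissible k β u I ∧
    ∀ (v : EuclideanSpace ℝ (Fin N)) (J : IntervalPartition N), Admissible k β v J →
      energy k β γ f u I ≤ energy k β γ f v J

/-- The functional of one segment with data `x`. -/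
def segmentEnergy (k : ℕ) (β : ℝ≥0∞) {n : ℕ} (x v : EuclideanSpace ℝ (Fin n)) : ℝ :=
  ‖v - x‖ ^ 2 + smoothness k β v

/-- `v = S x`: the signal `v` is the exact fit to the data `x` on one segment. -/
def IsSegmentFit (k : ℕ) (β : ℝ≥0∞) {n : ℕ} (x v : EuclideanSpace ℝ (Fin n)) : Prop :=
  SegmentAdmissible k β v ∧
    ∀ w : EuclideanSpace ℝ (Fin n), SegmentAdmissible k β w →
      segmentEnergy k β x v ≤ segmentEnergy k β x w

/-- The exact approximation error of one segment with data `x`. -/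
def segmentError (k : ℕ) (β : ℝ≥0∞) {n : ℕ} (x : EuclideanSpace ℝ (Fin n)) : ℝ :=
  sInf {e | ∃ v : EuclideanSpace ℝ (Fin n), SegmentAdmissible k β v ∧ e = segmentEnergy k β x v}

/-- The minimal functional value restricted to the equivalence class of the partition `I`. -/
def classEnergy (k : ℕ) (β : ℝ≥0∞) (γ : ℝ) {N : ℕ} (f : EuclideanSpace ℝ (Fin N))
    (I : IntervalPartition N) : ℝ :=
  ∑ p ∈ I.parts, segmentError k β (segment f p.1 p.2) + γ * I.classSize k

/-! ### Machine arithmetic -/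

/-- Machine arithmetic of precision `τ`: each computed elementary operation has the form
`fl (x ∘ y) = (x ∘ y) (1 + e)` with `|e| ≤ τ`. -/
structure MachineArith (τ : ℝ) where
  add : ℝ → ℝ → ℝ
  sub : ℝ → ℝ → ℝ
  mul : ℝ → ℝ → ℝ
  div : ℝ → ℝ → ℝ
  sqrt : ℝ → ℝ
  add_err : ∀ x y, |add x y - (x + y)| ≤ τ * |x + y|
  sub_err : ∀ x y, |sub x y - (x - y)| ≤ τ * |x - y|
  mul_err : ∀ x y, |mul x y - x * y| ≤ τ * |x * y|
  div_err : ∀ x y, y ≠ 0 → |div x y - x / y| ≤ τ * |x / y|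
  sqrt_err : ∀ x, 0 ≤ x → |sqrt x - Real.sqrt x| ≤ τ * Real.sqrt x

/-! ### QR solver by Givens rotations on one segment, in machine arithmetic

The rows of the system matrix are processed one after the other. -/

/-- The triangular factor `R`, the transformed data `q` belonging to the rows of `R`, and the
accumulated squared residual `E`. -/
structure QRState where
  R : ℕ → ℕ → ℝ
  q : ℕ → ℝ
  E : ℝ

/-- A row `w` of the system matrix, with data entry `y`, that is being eliminated. -/
structure PendingRow where
  w : ℕ → ℝ
  y : ℝ

/-- Elimination of entry `j` of the pending row by a Givens rotation with pivot `R j j`. With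
`a = w j` and `b = R j j` the rotation has `cos = b / ρ`, `sin = a / ρ`,
`ρ = sign b * √(a² + b²)`; it is the identity if `ρ = 0`. -/
def rotate {τ : ℝ} (M : MachineArith τ) (s : QRState × PendingRow) (j : ℕ) :
    QRState × PendingRow :=
  let a := s.2.w j
  let b := s.1.R j j
  let h := M.sqrt (M.add (M.mul a a) (M.mul b b))
  let ρ := if 0 ≤ b then h else -h
  let co := if ρ = 0 then 1 else M.div b ρ
  let si := if ρ = 0 then 0 else M.div a ρ
  ({ R := Function.update s.1.R j
        (fun m => M.add (M.mul co (s.1.R j m)) (M.mul si (s.2.w m)))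
     q := Function.update s.1.q j (M.add (M.mul co (s.1.q j)) (M.mul si s.2.y))
     E := s.1.E },
   { w := fun m => if m = j then 0 else M.sub (M.mul co (s.2.w m)) (M.mul si (s.1.R j m))
     y := M.sub (M.mul co s.2.y) (M.mul si (s.1.q j)) })

/-- The error update `E ← E + y²`. -/
def updateError {τ : ℝ} (M : MachineArith τ) (s : QRState × PendingRow) : QRState :=
  { s.1 with E := M.add s.1.E (M.mul s.2.y s.2.y) }

/-- Mumford-Shah step from segment length `r` to `r + 1` with new data entry `y`: a row of the
identity matrix is appended to `R`, and if `r ≥ k`, the new row of `βᵏ ∇ᵏ` (with data entry `0`),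
supported in columns `r - k, …, r`, is eliminated by `k + 1` rotations. -/
def splineStep {τ : ℝ} (M : MachineArith τ) (k : ℕ) (β : ℝ) (s : QRState) (r : ℕ) (y : ℝ) :
    QRState :=
  let s' : QRState :=
    { R := Function.update s.R r (fun m => if m = r then 1 else 0)
      q := Function.update s.q r y
      E := s.E }
  if r < k then s'
  else
    let row : PendingRow :=
      { w := fun m => if r - k ≤ m ∧ m ≤ r then
            β ^ k * ((-1) ^ (r - m) * (Nat.choose k (r - m) : ℝ)) else 0
        y := 0 }
    updateError M ((List.range' (r - k) (k + 1)).foldl (rotate M) (s', row))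

/-- Potts step from segment length `r` to `r + 1` with new data entry `y`: the row
`(1, n, …, n ^ (k - 1))`, `n = r + 1`, is eliminated against the rows of `R`. If `r < k`, what
remains becomes a new row of `R`. -/
def polyStep {τ : ℝ} (M : MachineArith τ) (k : ℕ) (s : QRState) (r : ℕ) (y : ℝ) : QRState :=
  let row : PendingRow := { w := fun m => if m < k then ((r : ℝ) + 1) ^ m else 0, y := y }
  let t := (List.range (min r k)).foldl (rotate M) (s, row)
  if r < k then
    { R := Function.update t.1.R r t.2.w, q := Function.update t.1.q r t.2.y, E := t.1.E }
  else updateError M t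

/-- The state of the QR algorithm after processing all the data `x` of a segment. -/
def runQR {τ : ℝ} (M : MachineArith τ) (k : ℕ) (β : ℝ≥0∞) {n : ℕ}
    (x : EuclideanSpace ℝ (Fin n)) : QRState :=
  (List.range n).foldl
    (fun s r => if β = ⊤ then polyStep M k s r (extend x r)
      else splineStep M k β.toReal s r (extend x r))
    { R := fun _ _ => 0, q := fun _ => 0, E := 0 }

/-- The computed approximation error of a segment. -/
def computedError {τ : ℝ} (M : MachineArith τ) (k : ℕ) (β : ℝ≥0∞) {n : ℕ}
    (x : EuclideanSpace ℝ (Fin n)) : ℝ :=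
  (runQR M k β x).E

/-- Back substitution for `R v = q` with `n` unknowns, where `R` is upper triangular with at most
`k` nonzero superdiagonals. -/
def backSubstitution {τ : ℝ} (M : MachineArith τ) (k n : ℕ) (s : QRState) : ℕ → ℝ :=
  (List.range n).reverse.foldl
    (fun v i => Function.update v i
      (M.div ((List.range' (i + 1) (min k (n - 1 - i))).foldl
        (fun acc j => M.sub acc (M.mul (s.R i j) (v j))) (s.q i)) (s.R i i)))
    (fun _ => 0)

/-- The computed fit on a segment. On segments of length at most `k` it is the data.
For `β = ∞` the machine computes the `k` polynomial coefficients, and the fit is the polynomial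
signal with these coefficients. -/
def computedFit {τ : ℝ} (M : MachineArith τ) (k : ℕ) (β : ℝ≥0∞) {n : ℕ}
    (x : EuclideanSpace ℝ (Fin n)) : EuclideanSpace ℝ (Fin n) :=
  if n ≤ k then x
  else if β = ⊤ then
    WithLp.toLp 2 fun i => ∑ j ∈ Finset.range k,
      backSubstitution M k k (runQR M k β x) j * ((i : ℝ) + 1) ^ j
  else WithLp.toLp 2 fun i => backSubstitution M k n (runQR M k β x) i

/-! ### The dynamic program with pruning

`err a b` is the approximation error of the interval `(a, b)`. A list entry `(a, s)` is a candidate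
left boundary `a` together with the right boundary `s` up to which its error has been updated. -/

/-- One pass of the inner loop at right boundary `r`, with current best value `p` and current best
left boundary `j`. Returns the new candidate list, best value and best left boundary.
A candidate is deleted if, while its error is updated from `s` to `r`, at some `t` the value
`P a + err a t` is at least the (current) value at `t`. The loop stops as soon as
`err a r + γ` exceeds the current best value. -/
def scan (err : ℕ → ℕ → ℝ) (γ : ℝ) (P : ℕ → ℝ) (r : ℕ) :
    List (ℕ × ℕ) → ℝ → ℕ → List (ℕ × ℕ) × ℝ × ℕ
  | [], p, j => ([], p, j)
  | (a, s) :: rest, p, j =>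
    open Classical in
    if ∃ t, s < t ∧ t ≤ r ∧ (if t = r then p else P t) ≤ P a + err a t then
      scan err γ P r rest p j
    else
      let b := P a + γ + err a r
      let p' := if b ≤ p then b else p
      let j' := if b ≤ p then a else j
      if p' < err a r + γ then ((a, r) :: rest, p', j')
      else
        let out := scan err γ P r rest p' j'
        ((a, r) :: out.1, out.2)

/-- Optimal values, last left boundaries and candidate list. -/
structure DPState where
  P : ℕ → ℝ
  J : ℕ → ℕ
  L : List (ℕ × ℕ)

/-- The body of the outer loop at right boundary `r`. -/
def dpStep (err : ℕ → ℕ → ℝ) (γ : ℝ) (s : DPState) (r : ℕ) : DPState :=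
  let out := scan err γ s.P r s.L (err 0 r) 0
  { P := Function.update s.P r out.2.1
    J := Function.update s.J r out.2.2
    L := (r, r + 1) :: out.1 }

/-- The outer loop `r = 2, …, N`. -/
def runDP (err : ℕ → ℕ → ℝ) (γ : ℝ) (N : ℕ) : DPState :=
  (List.range' 2 (N - 1)).foldl (dpStep err γ)
    { P := fun _ => 0, J := fun _ => 0, L := [(1, 2)] }

/-- Recovery of the segments from the boundary locations `J`, from right to left
(the first argument bounds the number of steps). -/
def recoverSegments (J : ℕ → ℕ) : ℕ → ℕ → List (ℕ × ℕ)
  | 0, _ => []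
  | m + 1, r => if r = 0 then [] else (J r, r) :: recoverSegments J m (J r)

/-- The segments found by the algorithm from the computed approximation errors. -/
def computedSegments {τ : ℝ} (M : MachineArith τ) (k : ℕ) (β : ℝ≥0∞) (γ : ℝ) {N : ℕ}
    (f : EuclideanSpace ℝ (Fin N)) : List (ℕ × ℕ) :=
  recoverSegments (runDP (fun a b => computedError M k β (segment f a b)) γ N).J N N

/-- The signal produced by the algorithm: the computed fits on the computed segments. -/
def computedSignal {τ : ℝ} (M : MachineArith τ) (k : ℕ) (β : ℝ≥0∞) (γ : ℝ) {N : ℕ}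
    (f : EuclideanSpace ℝ (Fin N)) : EuclideanSpace ℝ (Fin N) :=
  WithLp.toLp 2 fun i => (computedSegments M k β γ f).foldl
    (fun acc p => if p.1 ≤ (i : ℕ) ∧ (i : ℕ) < p.2 then
      extend (computedFit M k β (segment f p.1 p.2)) (i - p.1) else acc) 0

/-- The computed energy of (the class of) a partition. -/
def computedEnergy {τ : ℝ} (M : MachineArith τ) (k : ℕ) (β : ℝ≥0∞) (γ : ℝ) {N : ℕ}
    (f : EuclideanSpace ℝ (Fin N)) (I : IntervalPartition N) : ℝ :=
  ∑ p ∈ I.parts, computedError M k β (segment f p.1 p.2) + γ * I.classSize k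

/-! ### The quantities in the stability statement -/

/-- Relative backward error of the computed fit on segments of length `n` at precision `τ`: the
least `m` such that, in every arithmetic of precision `τ` and for all data `x`, the computed fit
is the exact fit to data `y` with `‖y - x‖ ≤ m ‖x‖`. -/
def backwardError (τ : ℝ) (k : ℕ) (β : ℝ≥0∞) (n : ℕ) : ℝ≥0∞ :=
  sInf {m | ∀ (M : MachineArith τ) (x : EuclideanSpace ℝ (Fin n)),
    ∃ y : EuclideanSpace ℝ (Fin n),
      IsSegmentFit k β y (computedFit M k β x) ∧ ‖y - x‖ₑ ≤ m * ‖x‖ₑ}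

/-- `δ_I(τ)² = ∑ δ_{l:r}(τ)²`, where `δ_{l:r}(τ)` is `C` times the relative backward error. -/
def deltaPartition (τ : ℝ) (k : ℕ) (β : ℝ≥0∞) (C : ℝ) {N : ℕ} (I : IntervalPartition N) : ℝ≥0∞ :=
  (∑ p ∈ I.parts, (backwardError τ k β (p.2 - p.1) * ENNReal.ofReal C) ^ 2) ^ (1 / 2 : ℝ)

/-- `δ*(τ)`, the maximum of `δ_I(τ)` over all partitions. -/
def deltaStar (τ : ℝ) (k : ℕ) (β : ℝ≥0∞) (C : ℝ) (N : ℕ) : ℝ≥0∞ :=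
  ⨆ I : IntervalPartition N, deltaPartition τ k β C I

/-- `g(τ)`: the worst deviation of the computed from the exact energies, over all arithmetics of
precision `τ`, all data of norm less than `C` and all partitions. -/
def energyErrorBound (τ : ℝ) (k : ℕ) (β : ℝ≥0∞) (γ C : ℝ) (N : ℕ) : ℝ≥0∞ :=
  ⨆ (M : MachineArith τ) (x : EuclideanSpace ℝ (Fin N)) (_ : ‖x‖ < C) (I : IntervalPartition N),
    ENNReal.ofReal |computedEnergy M k β γ x I - classEnergy k β γ x I|

/-- `δ = min (ε / (2 (2β) ^ (2k) (‖f‖ + 1/2)), 1/2)`; for `β = ∞` the factor `(2β) ^ (2k)`, which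
bounds the norms of the quadratic forms `f ↦ ∑_{I} Ec^I`, is replaced by the bound `1` that holds
there. -/
def stabilityRadius (k : ℕ) (β : ℝ≥0∞) (ε normf : ℝ) : ℝ :=
  min (ε / (2 * (if β = ⊤ then 1 else (2 * β.toReal) ^ (2 * k)) * (normf + 1 / 2))) (1 / 2)

end MumfordShah

end

open MumfordShah

/-!
The proof has three ingredients.

*The pruned dynamic program.* The computed errors need not be monotone or superadditive in the
interval, so the pruning rules are not exact for them. What survives without any assumption
is recorded in `DPSpec`: each value `P b` belongs to the tiling that is read off from the left
boundaries `J`, and a left boundary `a` is beaten unless a pruning rule has excluded it. Intervals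
of length at most `k` have error `0`, both exact and computed, so that there pruning is harmless
(`DPSpec.value_le_of_short`), and so that the bound `ε / 4` on the deviation of the energies holds
for tilings of every subinterval (`approxErrors_computedError`). Suppose now that pruning removes a
long interval from an optimal tiling. Superadditivity of the exact errors and two uses of the bound
`ε / 4` give a tiling of exact energy at most `ε / 2` above the optimum; by the margin `ε` it has
the same long intervals, so that nothing was lost (`DPSpec.value_add_le_tilingCost`). Hence the
partition that is found is equivalent to `I'` (`exists_tiles_computedSegments`).

*Stability of the optimal class.* On one interval the functional is strictly convex, and the exact
error is the square of a seminorm, bounded by `errorFactor` times the squared norm of the data.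
The triangle inequality bounds the change of the energies, and `stabilityRadius` is chosen such
that this change does not use up the margin (`classEnergy_lt_of_norm_sub_lt`). If one class has
strictly less energy than all others, the minimizing signal is unique and consists of the fits on
any partition of that class (`isMinimizer_iff_of_classEnergy_lt`), as the fits on short intervals
are the data.

*Backward errors.* On each interval found, the computed fit is the exact fit to nearby data, and the
infimum in `backwardError` is attained by compactness. The glued data `f'` are within `deltaStar`
of `f`, strictly because `‖f‖ < C` (`exists_isPartitionFit_of_computedFit`).
-/

open scoped ENNReal

namespace MumfordShah

open Finset

lemma add_sq_le_weighted {t : ℝ} (ht : 0 < t) (a b : ℝ) :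
    (a + b) ^ 2 ≤ (1 + t) * a ^ 2 + (1 + t⁻¹) * b ^ 2 := by
  have h : (1 + t) * a ^ 2 + (1 + t⁻¹) * b ^ 2 - (a + b) ^ 2 = t⁻¹ * (t * a - b) ^ 2 := by
    field_simp
    ring
  have h' : 0 ≤ t⁻¹ * (t * a - b) ^ 2 := by positivity
  linarith

/-! ### Signals and segments -/

lemma extend_of_lt {n : ℕ} (v : EuclideanSpace ℝ (Fin n)) {i : ℕ} (h : i < n) :
    extend v i = v ⟨i, h⟩ := dif_pos h

lemma extend_toLp {n : ℕ} (g : ℕ → ℝ) {i : ℕ} (h : i < n) :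
    extend (WithLp.toLp 2 fun j : Fin n => g j) i = g i := by
  rw [extend_of_lt _ h]

lemma extend_add {n : ℕ} (v w : EuclideanSpace ℝ (Fin n)) :
    extend (v + w) = extend v + extend w := by
  funext i
  by_cases h : i < n <;> simp [extend, h]

lemma extend_smul {n : ℕ} (c : ℝ) (v : EuclideanSpace ℝ (Fin n)) :
    extend (c • v) = c • extend v := by
  funext i
  by_cases h : i < n <;> simp [extend, h]

lemma continuous_extend {n : ℕ} (i : ℕ) :
    Continuous fun v : EuclideanSpace ℝ (Fin n) => extend v i := by
  by_cases h : i < n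
  · simp only [extend, h, dif_pos]
    fun_prop
  · simp only [extend, h, dif_neg, not_false_eq_true]
    fun_prop

lemma ext_extend {n : ℕ} {v w : EuclideanSpace ℝ (Fin n)}
    (h : ∀ i < n, extend v i = extend w i) : v = w := by
  ext ⟨i, hi⟩
  have := h i hi
  rwa [extend_of_lt _ hi, extend_of_lt _ hi] at this

lemma extend_segment {N : ℕ} (f : EuclideanSpace ℝ (Fin N)) {a b i : ℕ} (h : i < b - a) :
    extend (segment f a b) i = extend f (a + i) := by
  rw [segment, extend_toLp (fun i => extend f (a + i)) h]

lemma segment_add {N : ℕ} (f g : EuclideanSpace ℝ (Fin N)) (a b : ℕ) :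
    segment (f + g) a b = segment f a b + segment g a b := by
  ext i; simp [segment, extend_add]

lemma segment_sub {N : ℕ} (f g : EuclideanSpace ℝ (Fin N)) (a b : ℕ) :
    segment (f - g) a b = segment f a b - segment g a b := by
  have := segment_add (f - g) g a b
  rw [sub_add_cancel] at this
  rw [this, add_sub_cancel_right]

lemma norm_sq_eq_sum_extend {n : ℕ} (v : EuclideanSpace ℝ (Fin n)) :
    ‖v‖ ^ 2 = ∑ i ∈ range n, extend v i ^ 2 := by
  rw [EuclideanSpace.norm_sq_eq, Finset.sum_range]
  refine Finset.sum_congr rfl fun i _ => ?_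
  rw [extend_of_lt _ i.2, Real.norm_eq_abs, sq_abs]

lemma norm_sq_segment {N : ℕ} (f : EuclideanSpace ℝ (Fin N)) (a b : ℕ) :
    ‖segment f a b‖ ^ 2 = ∑ i ∈ Ico a b, extend f i ^ 2 := by
  rw [norm_sq_eq_sum_extend, sum_Ico_eq_sum_range]
  exact sum_congr rfl fun i hi => by rw [extend_segment _ (mem_range.1 hi)]

/-- Every signal on an interval is the restriction of a signal on the whole domain. -/
lemma exists_segment_eq {N a b : ℕ} (hb : b ≤ N) (v : EuclideanSpace ℝ (Fin (b - a))) :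
    ∃ V : EuclideanSpace ℝ (Fin N), segment V a b = v := by
  refine ⟨WithLp.toLp 2 fun i => extend v (i - a), ext_extend fun i hi => ?_⟩
  rw [extend_segment _ hi, extend_toLp (fun i => extend v (i - a)) (by omega)]
  simp

/-! ### The smoothness term and the polynomial constraint -/

lemma fwdDiff_iter_congr {g g' : ℕ → ℝ} {c k i : ℕ} (h : ∀ j ≤ k, g (i + j) = g' (c + i + j)) :
    (fwdDiff 1)^[k] g i = (fwdDiff 1)^[k] g' (c + i) := by
  rw [fwdDiff_iter_eq_sum_shift, fwdDiff_iter_eq_sum_shift]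
  refine sum_congr rfl fun j hj => ?_
  rw [smul_eq_mul, mul_one, h j (by simpa [Nat.lt_succ_iff] using hj)]

lemma sum_sq_fwdDiff_iter_le (g : ℕ → ℝ) (k m : ℕ) :
    ∑ i ∈ range m, ((fwdDiff 1)^[k] g i) ^ 2 ≤ 4 ^ k * ∑ i ∈ range (m + k), g i ^ 2 := by
  induction k generalizing m with
  | zero => simp
  | succ k ih =>
    have h1 : ∑ i ∈ range m, ((fwdDiff 1)^[k + 1] g i) ^ 2
        ≤ ∑ i ∈ range m, (2 * ((fwdDiff 1)^[k] g (i + 1)) ^ 2 + 2 * ((fwdDiff 1)^[k] g i) ^ 2) := by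
      refine sum_le_sum fun i _ => ?_
      rw [Function.iterate_succ_apply', fwdDiff]
      nlinarith [sq_nonneg ((fwdDiff 1)^[k] g (i + 1) + (fwdDiff 1)^[k] g i)]
    have h2 : ∑ i ∈ range m, ((fwdDiff 1)^[k] g (i + 1)) ^ 2
        ≤ ∑ i ∈ range (m + 1), ((fwdDiff 1)^[k] g i) ^ 2 := by
      rw [sum_range_succ']
      exact le_add_of_nonneg_right (sq_nonneg _)
    have h3 : ∑ i ∈ range m, ((fwdDiff 1)^[k] g i) ^ 2
        ≤ ∑ i ∈ range (m + 1), ((fwdDiff 1)^[k] g i) ^ 2 := by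
      rw [sum_range_succ]
      exact le_add_of_nonneg_right (sq_nonneg _)
    rw [sum_add_distrib, ← mul_sum, ← mul_sum] at h1
    have h4 := ih (m + 1)
    rw [show m + 1 + k = m + (k + 1) by ring] at h4
    rw [pow_succ]
    linarith

section

variable {k : ℕ} {β : ℝ≥0∞} {n : ℕ}

lemma smoothness_nonneg (v : EuclideanSpace ℝ (Fin n)) : 0 ≤ smoothness k β v := by
  unfold smoothness
  split_ifs
  · exact le_rfl
  · positivity

lemma smoothness_eq_zero_of_le (h : n ≤ k) (v : EuclideanSpace ℝ (Fin n)) :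
    smoothness k β v = 0 := by
  simp [smoothness, Nat.sub_eq_zero_of_le h]

lemma continuous_smoothness :
    Continuous fun v : EuclideanSpace ℝ (Fin n) => smoothness k β v := by
  unfold smoothness
  split_ifs
  · exact continuous_const
  · refine continuous_const.mul (continuous_finsetSum _ fun i _ => Continuous.pow ?_ 2)
    simp_rw [fwdDiff_iter_eq_sum_shift]
    exact continuous_finsetSum _ fun j _ => (continuous_extend _).fun_const_smul _

/-- The smoothness term is the squared norm of a linear image, so it obeys the weighted form
`(a + b)² ≤ (1 + t) a² + (1 + 1/t) b²` of the triangle inequality. -/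
lemma smoothness_add_le {t : ℝ} (ht : 0 < t) (v w : EuclideanSpace ℝ (Fin n)) :
    smoothness k β (v + w) ≤ (1 + t) * smoothness k β v + (1 + t⁻¹) * smoothness k β w := by
  unfold smoothness
  split_ifs
  · simp
  · have h : ∑ i ∈ range (n - k), ((fwdDiff 1)^[k] (extend (v + w)) i) ^ 2
        ≤ (1 + t) * ∑ i ∈ range (n - k), ((fwdDiff 1)^[k] (extend v) i) ^ 2
          + (1 + t⁻¹) * ∑ i ∈ range (n - k), ((fwdDiff 1)^[k] (extend w) i) ^ 2 := by
      rw [mul_sum, mul_sum, ← sum_add_distrib]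
      refine sum_le_sum fun i _ => ?_
      rw [extend_add, fwdDiff_iter_add, Pi.add_apply]
      exact add_sq_le_weighted ht _ _
    refine (mul_le_mul_of_nonneg_left h (by positivity)).trans_eq ?_
    ring

lemma smoothness_smul (c : ℝ) (v : EuclideanSpace ℝ (Fin n)) :
    smoothness k β (c • v) = c ^ 2 * smoothness k β v := by
  unfold smoothness
  split_ifs
  · simp
  · simp_rw [extend_smul, fwdDiff_iter_const_smul, Pi.smul_apply, smul_eq_mul, mul_pow, ← mul_sum]
    ring

lemma smoothness_zero : smoothness k β (0 : EuclideanSpace ℝ (Fin n)) = 0 := by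
  simpa using smoothness_smul (k := k) (β := β) 0 (0 : EuclideanSpace ℝ (Fin n))

variable (k β n) in
/-- The linear subspace of signals satisfying the constraint on one segment. -/
def admissibleSubmodule : Submodule ℝ (EuclideanSpace ℝ (Fin n)) where
  carrier := {v | SegmentAdmissible k β v}
  add_mem' := by
    intro v w hv hw hβ
    obtain ⟨p, hp, hpv⟩ := hv hβ
    obtain ⟨q, hq, hqw⟩ := hw hβ
    exact ⟨p + q, add_mem hp hq, fun i => by simp [hpv, hqw]⟩
  zero_mem' := fun _ => ⟨0, zero_mem _, fun i => by simp⟩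
  smul_mem' := by
    intro c v hv hβ
    obtain ⟨p, hp, hpv⟩ := hv hβ
    exact ⟨c • p, Submodule.smul_mem _ _ hp, fun i => by simp [hpv]⟩

/-- On a segment of length at most `k` every signal is a polynomial signal, by interpolation. -/
lemma segmentAdmissible_of_le (h : n ≤ k) (v : EuclideanSpace ℝ (Fin n)) :
    SegmentAdmissible k β v := by
  intro _
  have hinj : Set.InjOn (fun i : Fin n => (i : ℝ) + 1) (univ : Finset (Fin n)) := by
    intro i _ j _ hij
    have : (i : ℝ) = j := add_right_cancel hij
    exact Fin.ext (by exact_mod_cast this)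
  refine ⟨Lagrange.interpolate univ (fun i : Fin n => (i : ℝ) + 1) v, ?_, fun i => ?_⟩
  · rw [Polynomial.mem_degreeLT]
    refine (Lagrange.degree_interpolate_lt _ hinj).trans_le ?_
    simpa using h
  · exact (Lagrange.eval_interpolate_at_node _ hinj (mem_univ i)).symm

/-! ### Existence, uniqueness and perturbation of the fit on one segment -/

lemma segmentEnergy_nonneg (x v : EuclideanSpace ℝ (Fin n)) : 0 ≤ segmentEnergy k β x v :=
  add_nonneg (sq_nonneg _) (smoothness_nonneg v)

lemma continuous_segmentEnergy_right (x : EuclideanSpace ℝ (Fin n)) :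
    Continuous fun v => segmentEnergy k β x v :=
  Continuous.add (by fun_prop) continuous_smoothness

lemma continuous_segmentEnergy_left (v : EuclideanSpace ℝ (Fin n)) :
    Continuous fun x => segmentEnergy k β x v :=
  Continuous.add (by fun_prop) continuous_const

variable (k β) in
lemma exists_isSegmentFit (x : EuclideanSpace ℝ (Fin n)) : ∃ v, IsSegmentFit k β x v := by
  have hcomp : IsCompact ((admissibleSubmodule k β n : Set _) ∩ Metric.closedBall x ‖x‖) :=
    (isCompact_closedBall x ‖x‖).inter_left (Submodule.closed_of_finiteDimensional _)
  have h0 : (0 : EuclideanSpace ℝ (Fin n)) ∈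
      (admissibleSubmodule k β n : Set _) ∩ Metric.closedBall x ‖x‖ :=
    ⟨zero_mem _, by simp⟩
  obtain ⟨v, hv, hmin⟩ :=
    hcomp.exists_isMinOn ⟨0, h0⟩ (continuous_segmentEnergy_right (k := k) (β := β) x).continuousOn
  refine ⟨v, hv.1, fun w hw => ?_⟩
  by_cases hwx : w ∈ Metric.closedBall x ‖x‖
  · exact hmin ⟨hw, hwx⟩
  · refine (hmin h0).trans ?_
    rw [Metric.mem_closedBall, dist_eq_norm, not_le] at hwx
    have h1 := smoothness_nonneg (k := k) (β := β) w
    have h2 : ‖x‖ ^ 2 ≤ ‖w - x‖ ^ 2 := by gcongr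
    simp only [segmentEnergy, smoothness_zero, zero_sub, norm_neg]
    linarith

/-- The functional of one segment is strictly convex, whence the fit is unique. -/
lemma IsSegmentFit.unique {x v w : EuclideanSpace ℝ (Fin n)} (hv : IsSegmentFit k β x v)
    (hw : IsSegmentFit k β x w) : v = w := by
  have hadm : SegmentAdmissible k β ((1 / 2 : ℝ) • (v + w)) :=
    (admissibleSubmodule k β n).smul_mem _
      ((admissibleSubmodule k β n).add_mem (x := v) (y := w) hv.1 hw.1)
  have h1 := hv.2 _ hadm
  have h2 := hw.2 _ hv.1
  have hs : smoothness k β ((1 / 2 : ℝ) • (v + w))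
      ≤ 1 / 2 * smoothness k β v + 1 / 2 * smoothness k β w := by
    have := smoothness_add_le (k := k) (β := β) one_pos v w
    rw [smoothness_smul]
    norm_num at this ⊢
    linarith
  have hn : ‖(1 / 2 : ℝ) • (v + w) - x‖ ^ 2
      = 1 / 2 * ‖v - x‖ ^ 2 + 1 / 2 * ‖w - x‖ ^ 2 - 1 / 4 * ‖v - w‖ ^ 2 := by
    have hp := parallelogram_law_with_norm ℝ (v - x) (w - x)
    rw [show v - x + (w - x) = (2 : ℝ) • ((1 / 2 : ℝ) • (v + w) - x) by module,
      show v - x - (w - x) = v - w by abel, norm_smul, Real.norm_two] at hp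
    nlinarith
  simp only [segmentEnergy] at h1 h2
  have : ‖v - w‖ ^ 2 ≤ 0 := by linarith
  have : ‖v - w‖ = 0 := by nlinarith [norm_nonneg (v - w)]
  exact sub_eq_zero.1 (norm_eq_zero.1 this)

lemma bddBelow_segmentEnergy (x : EuclideanSpace ℝ (Fin n)) : BddBelow
    {e | ∃ v : EuclideanSpace ℝ (Fin n), SegmentAdmissible k β v ∧ e = segmentEnergy k β x v} :=
  ⟨0, by rintro _ ⟨v, -, rfl⟩; exact segmentEnergy_nonneg x v⟩

lemma segmentError_le {x v : EuclideanSpace ℝ (Fin n)} (hv : SegmentAdmissible k β v) :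
    segmentError k β x ≤ segmentEnergy k β x v :=
  csInf_le (bddBelow_segmentEnergy x) ⟨v, hv, rfl⟩

lemma IsSegmentFit.segmentEnergy_eq {x v : EuclideanSpace ℝ (Fin n)} (hv : IsSegmentFit k β x v) :
    segmentEnergy k β x v = segmentError k β x :=
  le_antisymm (le_csInf ⟨_, v, hv.1, rfl⟩ (by rintro _ ⟨w, hw, rfl⟩; exact hv.2 w hw))
    (segmentError_le hv.1)

lemma isSegmentFit_of_segmentEnergy_le {x v : EuclideanSpace ℝ (Fin n)}
    (hv : SegmentAdmissible k β v) (h : segmentEnergy k β x v ≤ segmentError k β x) :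
    IsSegmentFit k β x v :=
  ⟨hv, fun _ hw => h.trans (segmentError_le hw)⟩

lemma segmentError_nonneg (x : EuclideanSpace ℝ (Fin n)) : 0 ≤ segmentError k β x := by
  obtain ⟨v, hv⟩ := exists_isSegmentFit k β x
  exact hv.segmentEnergy_eq ▸ segmentEnergy_nonneg x v

lemma isSegmentFit_self (h : n ≤ k) (x : EuclideanSpace ℝ (Fin n)) : IsSegmentFit k β x x :=
  ⟨segmentAdmissible_of_le h x, fun w _ => by
    simp [segmentEnergy, smoothness_eq_zero_of_le h]⟩

lemma segmentError_eq_zero (h : n ≤ k) (x : EuclideanSpace ℝ (Fin n)) :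
    segmentError k β x = 0 := by
  rw [← (isSegmentFit_self h x).segmentEnergy_eq]
  simp [segmentEnergy, smoothness_eq_zero_of_le h]

lemma norm_add_sq_le_weighted {t : ℝ} (ht : 0 < t) (v w : EuclideanSpace ℝ (Fin n)) :
    ‖v + w‖ ^ 2 ≤ (1 + t) * ‖v‖ ^ 2 + (1 + t⁻¹) * ‖w‖ ^ 2 :=
  (pow_le_pow_left₀ (norm_nonneg _) (norm_add_le v w) 2).trans (add_sq_le_weighted ht _ _)

/-- The square root of the segment error is a seminorm; this is its triangle inequality, in the
weighted form that can be summed over the segments. -/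
lemma segmentError_add_le {t : ℝ} (ht : 0 < t) (x h : EuclideanSpace ℝ (Fin n)) :
    segmentError k β (x + h)
      ≤ (1 + t) * segmentError k β x + (1 + t⁻¹) * segmentError k β h := by
  obtain ⟨v, hv⟩ := exists_isSegmentFit k β x
  obtain ⟨w, hw⟩ := exists_isSegmentFit k β h
  have hadm : SegmentAdmissible k β (v + w) :=
    (admissibleSubmodule k β n).add_mem (x := v) (y := w) hv.1 hw.1
  refine (segmentError_le hadm).trans ?_
  rw [← hv.segmentEnergy_eq, ← hw.segmentEnergy_eq]
  have h1 := norm_add_sq_le_weighted ht (v - x) (w - h)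
  rw [show v - x + (w - h) = v + w - (x + h) by abel] at h1
  have h2 := smoothness_add_le (k := k) (β := β) ht v w
  simp only [segmentEnergy]
  linarith

variable (k β) in
/-- A bound for the norm of the quadratic form `segmentError`. -/
noncomputable def errorFactor : ℝ := if β = ⊤ then 1 else (2 * β.toReal) ^ (2 * k)

lemma segmentError_le_norm_sq (x : EuclideanSpace ℝ (Fin n)) :
    segmentError k β x ≤ errorFactor k β * ‖x‖ ^ 2 := by
  by_cases hβ : β = ⊤
  · refine (segmentError_le (admissibleSubmodule k β n).zero_mem).trans ?_
    simp [segmentEnergy, smoothness_zero, errorFactor, hβ]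
  · refine (segmentError_le (v := x) fun h => absurd h hβ).trans ?_
    have h : ∑ i ∈ range (n - k), ((fwdDiff 1)^[k] (extend x) i) ^ 2 ≤ 4 ^ k * ‖x‖ ^ 2 := by
      rw [norm_sq_eq_sum_extend]
      rcases le_total k n with hkn | hkn
      · simpa [Nat.sub_add_cancel hkn] using sum_sq_fwdDiff_iter_le (extend x) k (n - k)
      · rw [Nat.sub_eq_zero_of_le hkn, sum_range_zero]
        positivity
    simp only [segmentEnergy, smoothness, errorFactor, hβ, if_false, sub_self, norm_zero]
    refine le_of_eq_of_le (by ring) ((mul_le_mul_of_nonneg_left h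
      (by positivity : 0 ≤ β.toReal ^ (2 * k))).trans_eq ?_)
    rw [mul_pow, pow_mul (2 : ℝ)]
    norm_num
    ring

end

/-! ### Segments of one signal -/

section

variable {k : ℕ} {β : ℝ≥0∞} {N : ℕ}

lemma smoothness_segment (hβ : β ≠ ⊤) (f : EuclideanSpace ℝ (Fin N)) (a b : ℕ) :
    smoothness k β (segment f a b)
      = β.toReal ^ (2 * k) * ∑ i ∈ Ico a (b - k), ((fwdDiff 1)^[k] (extend f) i) ^ 2 := by
  rw [smoothness, if_neg hβ, sum_Ico_eq_sum_range, Nat.sub_right_comm]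
  congr 1
  refine sum_congr rfl fun i hi => ?_
  rw [mem_range] at hi
  rw [fwdDiff_iter_congr (c := a)]
  intro j hj
  rw [extend_segment _ (by omega), add_assoc]

lemma segmentAdmissible_subsegment {V : EuclideanSpace ℝ (Fin N)} {a b c d : ℕ}
    (hV : SegmentAdmissible k β (segment V a b)) (hac : a ≤ c) (hdb : d ≤ b) :
    SegmentAdmissible k β (segment V c d) := by
  intro hβ
  obtain ⟨p, hp, hpV⟩ := hV hβ
  refine ⟨p.comp (Polynomial.X + Polynomial.C ((c - a : ℕ) : ℝ)), ?_, fun i => ?_⟩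
  · rw [Polynomial.mem_degreeLT] at hp ⊢
    rcases eq_or_ne p 0 with rfl | h0
    · simp
    · rw [Polynomial.degree_eq_natDegree h0] at hp
      refine lt_of_le_of_lt Polynomial.degree_le_natDegree ?_
      rw [Polynomial.natDegree_comp, Polynomial.natDegree_X_add_C, mul_one]
      exact hp
  · have hi := i.2
    have h := hpV ⟨c - a + i, by omega⟩
    simp only [segment] at h ⊢
    rw [show a + (c - a + (i : ℕ)) = c + i by omega] at h
    rw [h]
    simp only [Polynomial.eval_comp, Polynomial.eval_add, Polynomial.eval_X, Polynomial.eval_C]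
    push_cast
    ring_nf

/-- Cutting an interval in two does not increase the error. -/
lemma segmentError_add_le_segmentError (f : EuclideanSpace ℝ (Fin N)) {a t b : ℕ} (hat : a ≤ t)
    (htb : t ≤ b) (hb : b ≤ N) :
    segmentError k β (segment f a t) + segmentError k β (segment f t b)
      ≤ segmentError k β (segment f a b) := by
  obtain ⟨v, hv⟩ := exists_isSegmentFit k β (segment f a b)
  obtain ⟨V, rfl⟩ := exists_segment_eq hb v
  rw [← hv.segmentEnergy_eq]
  refine (add_le_add (segmentError_le (segmentAdmissible_subsegment hv.1 le_rfl htb))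
    (segmentError_le (segmentAdmissible_subsegment hv.1 hat le_rfl))).trans ?_
  simp only [segmentEnergy, ← segment_sub, norm_sq_segment]
  have hn := sum_Ico_consecutive (fun i => extend (V - f) i ^ 2) hat htb
  have hs : smoothness k β (segment V a t) + smoothness k β (segment V t b)
      ≤ smoothness k β (segment V a b) := by
    by_cases hβ : β = ⊤
    · simp [smoothness, hβ]
    · rw [smoothness_segment hβ, smoothness_segment hβ, smoothness_segment hβ, ← mul_add]
      refine mul_le_mul_of_nonneg_left ?_ (by positivity)
      rw [← sum_union]
      · refine sum_le_sum_of_subset_of_nonneg ?_ fun _ _ _ => sq_nonneg _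
        intro i
        simp only [mem_union, mem_Ico]
        omega
      · rw [disjoint_left]
        intro i
        simp only [mem_Ico]
        omega
  linarith

end

/-! ### Partitions into intervals -/

namespace IntervalPartition

variable {N k : ℕ}

lemma eq_of_mem (I : IntervalPartition N) {p q : ℕ × ℕ} (hp : p ∈ I.parts) (hq : q ∈ I.parts)
    {n : ℕ} (hpn : p.1 ≤ n ∧ n < p.2) (hqn : q.1 ≤ n ∧ n < q.2) : p = q :=
  (I.cover n (hpn.2.trans_le (I.valid p hp).2)).unique ⟨hp, hpn⟩ ⟨hq, hqn⟩

lemma sum_parts (I : IntervalPartition N) (g : ℕ → ℝ) :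
    ∑ p ∈ I.parts, ∑ i ∈ Ico p.1 p.2, g i = ∑ i ∈ range N, g i := by
  rw [← sum_biUnion]
  · congr 1
    ext n
    simp only [mem_biUnion, mem_Ico, mem_range]
    constructor
    · rintro ⟨p, hp, hn⟩
      exact hn.2.trans_le (I.valid p hp).2
    · intro hn
      obtain ⟨p, ⟨hp, hpn⟩, -⟩ := I.cover n hn
      exact ⟨p, hp, hpn⟩
  · intro p hp q hq hpq
    rw [Function.onFun, disjoint_left]
    intro n hn hn'
    rw [mem_Ico] at hn hn'
    exact hpq (I.eq_of_mem hp hq hn hn')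

/-- Signals on the intervals of a partition can be glued to one signal. -/
lemma exists_segment_eq (I : IntervalPartition N)
    (v : ∀ p : ℕ × ℕ, EuclideanSpace ℝ (Fin (p.2 - p.1))) :
    ∃ V : EuclideanSpace ℝ (Fin N), ∀ p ∈ I.parts, segment V p.1 p.2 = v p := by
  choose! part hpart _ using I.cover
  refine ⟨WithLp.toLp 2 fun i => extend (v (part i)) (i - (part i).1), fun p hp => ?_⟩
  have hN := (I.valid p hp).2
  refine ext_extend fun i hi => ?_
  rw [extend_segment _ hi,
    extend_toLp (fun i => extend (v (part i)) (i - (part i).1)) (by omega),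
    I.eq_of_mem (hpart (p.1 + i) (by omega)).1 hp (hpart (p.1 + i) (by omega)).2 (by omega),
    Nat.add_sub_cancel_left]

lemma ext_segment (I : IntervalPartition N) {u v : EuclideanSpace ℝ (Fin N)}
    (h : ∀ p ∈ I.parts, segment u p.1 p.2 = segment v p.1 p.2) : u = v := by
  refine ext_extend fun i hi => ?_
  obtain ⟨p, ⟨hp, hpi⟩, -⟩ := I.cover i hi
  have := congrArg (fun w => extend w (i - p.1)) (h p hp)
  rwa [extend_segment _ (by omega), extend_segment _ (by omega), Nat.add_sub_cancel' hpi.1] at this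

lemma norm_sq_eq_sum (I : IntervalPartition N) (x : EuclideanSpace ℝ (Fin N)) :
    ‖x‖ ^ 2 = ∑ p ∈ I.parts, ‖segment x p.1 p.2‖ ^ 2 := by
  simp_rw [norm_sq_segment]
  rw [I.sum_parts, norm_sq_eq_sum_extend]

lemma classSize_le_size (I : IntervalPartition N) : I.classSize k ≤ I.size :=
  Nat.sInf_le ⟨I, rfl, rfl⟩

lemma exists_size_eq_classSize (k : ℕ) (I : IntervalPartition N) :
    ∃ K : IntervalPartition N, Equivalent k K I ∧ K.size = I.classSize k :=
  Nat.sInf_mem (s := {m | ∃ J : IntervalPartition N, Equivalent k J I ∧ J.size = m})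
    ⟨_, I, rfl, rfl⟩

lemma Equivalent.classSize_eq {I J : IntervalPartition N} (h : Equivalent k I J) :
    I.classSize k = J.classSize k := by
  unfold classSize Equivalent at *
  rw [h]

lemma mem_longParts {I : IntervalPartition N} {p : ℕ × ℕ} :
    p ∈ I.longParts k ↔ p ∈ I.parts ∧ k < p.2 - p.1 := mem_filter

lemma Equivalent.mem_of_long {I J : IntervalPartition N} (h : Equivalent k I J) {p : ℕ × ℕ}
    (hp : p ∈ I.parts) (hk : k < p.2 - p.1) : p ∈ J.parts := by
  have : p ∈ I.longParts k := mem_longParts.2 ⟨hp, hk⟩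
  rw [h] at this
  exact (mem_longParts.1 this).1

end IntervalPartition

/-! ### Minimizers of the exact problem -/

section

variable {k : ℕ} {β : ℝ≥0∞} {γ : ℝ} {N : ℕ}

lemma energy_eq_sum (f u : EuclideanSpace ℝ (Fin N)) (I : IntervalPartition N) :
    energy k β γ f u I
      = ∑ p ∈ I.parts, segmentEnergy k β (segment f p.1 p.2) (segment u p.1 p.2)
        + γ * I.size := by
  simp only [energy, segmentEnergy, sum_add_distrib, ← segment_sub]
  rw [I.norm_sq_eq_sum]

lemma sum_segmentError_congr (f : EuclideanSpace ℝ (Fin N)) {I J : IntervalPartition N}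
    (h : IntervalPartition.Equivalent k I J) :
    ∑ p ∈ I.parts, segmentError k β (segment f p.1 p.2)
      = ∑ p ∈ J.parts, segmentError k β (segment f p.1 p.2) := by
  have key : ∀ K : IntervalPartition N, ∑ p ∈ K.longParts k, segmentError k β (segment f p.1 p.2)
      = ∑ p ∈ K.parts, segmentError k β (segment f p.1 p.2) := fun K =>
    sum_filter_of_ne fun p _ hne => by
      by_contra hk
      exact hne (segmentError_eq_zero (not_lt.1 hk) _)
  rw [← key, ← key, h]

lemma classEnergy_congr (f : EuclideanSpace ℝ (Fin N)) {I J : IntervalPartition N}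
    (h : IntervalPartition.Equivalent k I J) : classEnergy k β γ f I = classEnergy k β γ f J := by
  rw [classEnergy, classEnergy, sum_segmentError_congr f h, h.classSize_eq]

lemma classEnergy_le_energy (hγ : 0 ≤ γ) {f u : EuclideanSpace ℝ (Fin N)}
    {I : IntervalPartition N} (hu : Admissible k β u I) :
    classEnergy k β γ f I ≤ energy k β γ f u I := by
  rw [energy_eq_sum, classEnergy]
  exact add_le_add (sum_le_sum fun p hp => segmentError_le (hu p hp))
    (mul_le_mul_of_nonneg_left (by exact_mod_cast I.classSize_le_size) hγ)

/-- `u` consists of the fits to the data `f` on the intervals of `I`. -/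
def IsPartitionFit (k : ℕ) (β : ℝ≥0∞) {N : ℕ} (f u : EuclideanSpace ℝ (Fin N))
    (I : IntervalPartition N) : Prop :=
  ∀ p ∈ I.parts, IsSegmentFit k β (segment f p.1 p.2) (segment u p.1 p.2)

variable (k β) in
lemma exists_isPartitionFit (f : EuclideanSpace ℝ (Fin N)) (I : IntervalPartition N) :
    ∃ u, IsPartitionFit k β f u I := by
  choose v hv using fun p : ℕ × ℕ => exists_isSegmentFit k β (segment f p.1 p.2)
  obtain ⟨u, hu⟩ := I.exists_segment_eq v
  exact ⟨u, fun p hp => hu p hp ▸ hv p⟩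

lemma IsPartitionFit.unique {f u v : EuclideanSpace ℝ (Fin N)} {I : IntervalPartition N}
    (hu : IsPartitionFit k β f u I) (hv : IsPartitionFit k β f v I) : u = v :=
  I.ext_segment fun p hp => (hu p hp).unique (hv p hp)

/-- The fit depends on the equivalence class of the partition only, as it reproduces the data on
the short intervals. -/
lemma IsPartitionFit.congr {f u : EuclideanSpace ℝ (Fin N)} {I J : IntervalPartition N}
    (hu : IsPartitionFit k β f u I) (h : IntervalPartition.Equivalent k I J) :
    IsPartitionFit k β f u J := by
  intro p hp
  by_cases hk : k < p.2 - p.1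
  · exact hu p (IntervalPartition.Equivalent.mem_of_long h.symm hp hk)
  · rw [not_lt] at hk
    convert isSegmentFit_self hk (segment f p.1 p.2) using 1
    refine ext_extend fun i hi => ?_
    rw [extend_segment _ hi, extend_segment _ hi]
    have hpi : p.1 ≤ p.1 + i ∧ p.1 + i < p.2 := by omega
    obtain ⟨q, ⟨hq, hqi⟩, -⟩ := I.cover (p.1 + i) (hpi.2.trans_le (J.valid p hp).2)
    have hkq : q.2 - q.1 ≤ k := by
      by_contra hkq
      rw [J.eq_of_mem (h.mem_of_long hq (not_le.1 hkq)) hp hqi hpi] at hkq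
      exact hkq hk
    have := congrArg (fun w => extend w (p.1 + i - q.1))
      ((hu q hq).unique (isSegmentFit_self hkq _))
    rwa [extend_segment _ (by omega), extend_segment _ (by omega),
      Nat.add_sub_cancel' hqi.1] at this

lemma IsPartitionFit.admissible {f u : EuclideanSpace ℝ (Fin N)} {I : IntervalPartition N}
    (hu : IsPartitionFit k β f u I) : Admissible k β u I := fun p hp => (hu p hp).1

lemma IsPartitionFit.energy_eq {f u : EuclideanSpace ℝ (Fin N)} {I : IntervalPartition N}
    (hu : IsPartitionFit k β f u I) :
    energy k β γ f u I
      = ∑ p ∈ I.parts, segmentError k β (segment f p.1 p.2) + γ * I.size := by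
  rw [energy_eq_sum, sum_congr rfl fun p hp => (hu p hp).segmentEnergy_eq]

/-- If one class of partitions has strictly less energy than all others, then the minimizing
signal is unique, and it is the fit on any partition of that class. -/
lemma isMinimizer_iff_of_classEnergy_lt (hγ : 0 ≤ γ) {f u : EuclideanSpace ℝ (Fin N)}
    {J : IntervalPartition N} (hu : IsPartitionFit k β f u J)
    (hJ : ∀ I : IntervalPartition N, ¬ IntervalPartition.Equivalent k I J →
      classEnergy k β γ f J < classEnergy k β γ f I) (w : EuclideanSpace ℝ (Fin N)) :
    IsMinimizer k β γ f w ↔ w = u := by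
  obtain ⟨K, hKJ, hK⟩ := J.exists_size_eq_classSize k
  have huK : IsPartitionFit k β f u K := hu.congr hKJ.symm
  have hEK : energy k β γ f u K = classEnergy k β γ f J := by
    rw [huK.energy_eq, hK, sum_segmentError_congr f hKJ, classEnergy]
  constructor
  · rintro ⟨I, hwI, hmin⟩
    have h1 := (hmin u K huK.admissible).trans_eq hEK
    have hIJ : IntervalPartition.Equivalent k I J := by
      by_contra hne
      exact absurd ((hJ I hne).trans_le (classEnergy_le_energy hγ hwI)) (not_lt.2 h1)
    have h2 : ∑ p ∈ I.parts, segmentEnergy k β (segment f p.1 p.2) (segment w p.1 p.2)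
        ≤ ∑ p ∈ I.parts, segmentError k β (segment f p.1 p.2) := by
      rw [← classEnergy_congr f hIJ, energy_eq_sum, classEnergy] at h1
      have : γ * (I.classSize k : ℝ) ≤ γ * I.size :=
        mul_le_mul_of_nonneg_left (by exact_mod_cast I.classSize_le_size) hγ
      linarith
    have h3 := (sum_eq_sum_iff_of_le fun p hp => segmentError_le (hwI p hp)).1
      (le_antisymm (sum_le_sum fun p hp => segmentError_le (hwI p hp)) h2)
    have hw : IsPartitionFit k β f w I := fun p hp =>
      isSegmentFit_of_segmentEnergy_le (hwI p hp) (h3 p hp).ge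
    exact hw.unique (hu.congr hIJ.symm)
  · rintro rfl
    refine ⟨K, huK.admissible, fun v I hv => hEK.trans_le ?_⟩
    refine le_trans ?_ (classEnergy_le_energy hγ hv)
    by_cases hIJ : IntervalPartition.Equivalent k I J
    · exact (classEnergy_congr f hIJ).ge
    · exact (hJ I hIJ).le

/-! ### Perturbation of the data -/

lemma sum_segmentError_le_norm_sq (x : EuclideanSpace ℝ (Fin N)) (I : IntervalPartition N) :
    ∑ p ∈ I.parts, segmentError k β (segment x p.1 p.2) ≤ errorFactor k β * ‖x‖ ^ 2 := by
  rw [I.norm_sq_eq_sum, mul_sum]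
  exact sum_le_sum fun p _ => segmentError_le_norm_sq _

lemma errorFactor_nonneg : 0 ≤ errorFactor k β := by
  unfold errorFactor
  split_ifs <;> positivity

lemma errorFactor_pos (hβ : 0 < β) : 0 < errorFactor k β := by
  unfold errorFactor
  split_ifs with h
  · exact one_pos
  · have := ENNReal.toReal_pos hβ.ne' h
    positivity

lemma sum_segmentError_sub_le {x y : EuclideanSpace ℝ (Fin N)} {A : ℝ} (hA : 0 < A)
    (hx : ‖x‖ ≤ A) (I : IntervalPartition N) :
    ∑ p ∈ I.parts, segmentError k β (segment y p.1 p.2)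
        - ∑ p ∈ I.parts, segmentError k β (segment x p.1 p.2)
      ≤ errorFactor k β * (2 * A * ‖y - x‖ + ‖y - x‖ ^ 2) := by
  rcases eq_or_ne y x with rfl | hne
  · simp
  set d := ‖y - x‖ with hd
  have hd0 : 0 < d := norm_pos_iff.2 (sub_ne_zero.2 hne)
  -- The weight that makes the two error terms below equal.
  have ht : 0 < d / A := div_pos hd0 hA
  have h1 : ∑ p ∈ I.parts, segmentError k β (segment y p.1 p.2)
      ≤ (1 + d / A) * ∑ p ∈ I.parts, segmentError k β (segment x p.1 p.2)
        + (1 + (d / A)⁻¹) * ∑ p ∈ I.parts, segmentError k β (segment (y - x) p.1 p.2) := by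
    rw [mul_sum, mul_sum, ← sum_add_distrib]
    refine sum_le_sum fun p _ => ?_
    have := segmentError_add_le (k := k) (β := β) ht (segment x p.1 p.2) (segment (y - x) p.1 p.2)
    rwa [← segment_add, add_sub_cancel] at this
  have h2 : ∑ p ∈ I.parts, segmentError k β (segment x p.1 p.2) ≤ errorFactor k β * A ^ 2 :=
    (sum_segmentError_le_norm_sq x I).trans
      (mul_le_mul_of_nonneg_left (by gcongr) errorFactor_nonneg)
  have h3 := sum_segmentError_le_norm_sq (k := k) (β := β) (y - x) I
  have h4 := mul_le_mul_of_nonneg_left h2 ht.le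
  have h5 := mul_le_mul_of_nonneg_left h3 (by positivity : 0 ≤ 1 + (d / A)⁻¹)
  have h6 : d / A * (errorFactor k β * A ^ 2) + (1 + (d / A)⁻¹) * (errorFactor k β * d ^ 2)
      = errorFactor k β * (2 * A * d + d ^ 2) := by
    field_simp
    ring
  linarith

/-- An energy margin `ε` between two classes at `f` persists, with margin `0`, at all data within
half the stability radius. -/
lemma classEnergy_lt_of_norm_sub_lt (hβ : 0 < β) {ε : ℝ} {f f' : EuclideanSpace ℝ (Fin N)}
    {I J : IntervalPartition N} (hIJ : classEnergy k β γ f J < classEnergy k β γ f I - ε)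
    (hf : ‖f' - f‖ < stabilityRadius k β ε ‖f‖ / 2) :
    classEnergy k β γ f' J < classEnergy k β γ f' I := by
  set d := ‖f' - f‖ with hd
  have hd0 : 0 ≤ d := norm_nonneg _
  have hc := errorFactor_pos (k := k) hβ
  have hf0 := norm_nonneg f
  have hd1 : d < 1 / 4 := by
    have := min_le_right (ε / (2 * errorFactor k β * (‖f‖ + 1 / 2))) (1 / 2)
    rw [stabilityRadius] at hf
    change d < min (ε / (2 * errorFactor k β * (‖f‖ + 1 / 2))) (1 / 2) / 2 at hf
    linarith
  have hd2 : d * (4 * errorFactor k β * (‖f‖ + 1 / 2)) < ε := by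
    have := min_le_left (ε / (2 * errorFactor k β * (‖f‖ + 1 / 2))) (1 / 2)
    change d < min (ε / (2 * errorFactor k β * (‖f‖ + 1 / 2))) (1 / 2) / 2 at hf
    have h : d * 2 < ε / (2 * errorFactor k β * (‖f‖ + 1 / 2)) := by linarith
    rw [lt_div_iff₀ (by positivity)] at h
    linarith
  have hf' : ‖f'‖ ≤ ‖f‖ + 1 / 4 := by
    have := norm_le_norm_add_norm_sub f f'
    rw [norm_sub_rev] at this
    linarith
  have h1 := sum_segmentError_sub_le (k := k) (β := β) (x := f) (y := f') (A := ‖f‖ + 1 / 4)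
    (by positivity) (by linarith) J
  have h2 := sum_segmentError_sub_le (k := k) (β := β) (x := f') (y := f) (A := ‖f‖ + 1 / 4)
    (by positivity) hf' I
  rw [norm_sub_rev f f'] at h2
  rw [← hd] at h1 h2
  have h3 : errorFactor k β * (2 * (‖f‖ + 1 / 4) * d + d ^ 2)
      + errorFactor k β * (2 * (‖f‖ + 1 / 4) * d + d ^ 2)
      ≤ d * (4 * errorFactor k β * (‖f‖ + 1 / 2)) := by
    have : 0 ≤ errorFactor k β * d * (1 - 2 * d) :=
      mul_nonneg (mul_nonneg hc.le hd0) (by linarith)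
    nlinarith
  simp only [classEnergy] at hIJ ⊢
  linarith

end

/-! ### The dynamic program with pruning, for arbitrary errors -/

section

variable {err : ℕ → ℕ → ℝ} {γ : ℝ} {P : ℕ → ℝ} {r : ℕ}

/-- The second pruning rule: some interval end `t`, `a < t ≤ r`, bears witness that `a` is not
needed as a left boundary. The value at `r` itself is `p`. -/
def IsDiscarded (err : ℕ → ℕ → ℝ) (P : ℕ → ℝ) (r : ℕ) (p : ℝ) (a : ℕ) : Prop :=
  ∃ t, a < t ∧ t ≤ r ∧ (if t = r then p else P t) ≤ P a + err a t

lemma IsDiscarded.mono {p p' : ℝ} {a : ℕ} (h : IsDiscarded err P r p a) (hp : p' ≤ p) :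
    IsDiscarded err P r p' a := by
  obtain ⟨t, hat, htr, ht⟩ := h
  refine ⟨t, hat, htr, le_trans ?_ ht⟩
  split_ifs
  · exact hp
  · exact le_rfl

lemma scan_value_le (L : List (ℕ × ℕ)) (p : ℝ) (j : ℕ) : (scan err γ P r L p j).2.1 ≤ p := by
  induction L generalizing p j with
  | nil => exact le_rfl
  | cons c L ih =>
    obtain ⟨a, s⟩ := c
    simp only [scan]
    split_ifs with h1 h2 h3 h3
    · exact ih p j
    · exact h2
    · exact (ih _ _).trans h2
    · exact le_rfl
    · exact ih _ _

lemma scan_boundary (L : List (ℕ × ℕ)) (p : ℝ) (j : ℕ) :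
    (scan err γ P r L p j).2 = (p, j) ∨ ∃ c ∈ L,
      (scan err γ P r L p j).2 = (P c.1 + γ + err c.1 r, c.1) := by
  induction L generalizing p j with
  | nil => exact Or.inl rfl
  | cons c L ih =>
    obtain ⟨a, s⟩ := c
    have hmono : ∀ {q : ℝ} {i : ℕ}, (∃ c ∈ L,
        (scan err γ P r L q i).2 = (P c.1 + γ + err c.1 r, c.1)) →
        ∃ c ∈ (a, s) :: L, (scan err γ P r L q i).2 = (P c.1 + γ + err c.1 r, c.1) :=
      fun ⟨c, hc, h⟩ => ⟨c, List.mem_cons_of_mem _ hc, h⟩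
    simp only [scan]
    split_ifs with h1 h2 h3 h3
    · exact (ih p j).imp_right hmono
    · exact Or.inr ⟨(a, s), List.mem_cons_self, rfl⟩
    · rcases ih (P a + γ + err a r) a with h | h
      · exact Or.inr ⟨(a, s), List.mem_cons_self, h⟩
      · exact Or.inr (hmono h)
    · exact Or.inl rfl
    · exact (ih p j).imp_right hmono

lemma scan_sublist (L : List (ℕ × ℕ)) (p : ℝ) (j : ℕ) :
    ((scan err γ P r L p j).1.map Prod.fst).Sublist (L.map Prod.fst) := by
  induction L generalizing p j with
  | nil => exact List.Sublist.refl _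
  | cons c L ih =>
    obtain ⟨a, s⟩ := c
    simp only [scan]
    split_ifs with h1 h2 h3 h3
    · exact (ih p j).cons _
    · exact List.Sublist.refl _
    · exact (ih _ _).cons_cons _
    · exact List.Sublist.refl _
    · exact (ih _ _).cons_cons _

lemma scan_mem {L : List (ℕ × ℕ)} {p : ℝ} {j : ℕ} {c : ℕ × ℕ}
    (hc : c ∈ (scan err γ P r L p j).1) : c ∈ L ∨ c.2 = r := by
  induction L generalizing p j with
  | nil => exact Or.inl hc
  | cons c' L ih =>
    obtain ⟨a, s⟩ := c'
    simp only [scan] at hc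
    split_ifs at hc with h1 h2 h3 h3
    · exact (ih hc).imp_left (List.mem_cons_of_mem _)
    all_goals
      rcases List.mem_cons.1 hc with rfl | hc
      · exact Or.inr rfl
    · exact Or.inl (List.mem_cons_of_mem _ hc)
    · exact (ih hc).imp_left (List.mem_cons_of_mem _)
    · exact Or.inl (List.mem_cons_of_mem _ hc)
    · exact (ih hc).imp_left (List.mem_cons_of_mem _)

/-- Every candidate is compared with the value found, unless the search stopped before it or
the second pruning rule applies to it. -/
lemma scan_le_or {L : List (ℕ × ℕ)} (p : ℝ) (j : ℕ)
    (hL : (L.map Prod.fst).Pairwise (· > ·)) (hr : ∀ c ∈ L, c.1 ≤ c.2 ∧ c.1 < r)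
    {c : ℕ × ℕ} (hc : c ∈ L) :
    (scan err γ P r L p j).2.1 ≤ P c.1 + γ + err c.1 r ∨
      (∃ l, c.1 < l ∧ l < r ∧ (scan err γ P r L p j).2.1 < err l r + γ) ∨
      IsDiscarded err P r (scan err γ P r L p j).2.1 c.1 := by
  induction L generalizing p j with
  | nil => simp at hc
  | cons c' L ih =>
    obtain ⟨a, s⟩ := c'
    rw [List.map_cons, List.pairwise_cons] at hL
    have hs := hr _ List.mem_cons_self
    have ih' := fun q i => ih q i hL.2 fun c hc => hr c (List.mem_cons_of_mem _ hc)
    have hlt : c ∈ L → c.1 < a := fun h => hL.1 _ (List.mem_map_of_mem h)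
    simp only [scan]
    split_ifs with h1 h2 h3 h3
    · rcases List.mem_cons.1 hc with rfl | hc
      · obtain ⟨t, hst, htr, ht⟩ := h1
        have : IsDiscarded err P r p a := ⟨t, hs.1.trans_lt hst, htr, ht⟩
        exact Or.inr (Or.inr (this.mono (scan_value_le _ _ _)))
      · exact ih' p j hc
    · rcases List.mem_cons.1 hc with rfl | hc
      · exact Or.inl le_rfl
      · exact Or.inr (Or.inl ⟨a, hlt hc, hs.2, h3⟩)
    · rcases List.mem_cons.1 hc with rfl | hc
      · exact Or.inl (scan_value_le _ _ _)
      · exact ih' _ _ hc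
    · rcases List.mem_cons.1 hc with rfl | hc
      · exact Or.inl (not_le.1 h2).le
      · exact Or.inr (Or.inl ⟨a, hlt hc, hs.2, h3⟩)
    · rcases List.mem_cons.1 hc with rfl | hc
      · exact Or.inl ((scan_value_le _ _ _).trans (not_le.1 h2).le)
      · exact ih' _ _ hc

lemma scan_survives_or {L : List (ℕ × ℕ)} (p : ℝ) (j : ℕ) (hr : ∀ c ∈ L, c.1 ≤ c.2)
    {a : ℕ} (ha : a ∈ L.map Prod.fst) :
    a ∈ (scan err γ P r L p j).1.map Prod.fst ∨
      IsDiscarded err P r (scan err γ P r L p j).2.1 a := by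
  induction L generalizing p j with
  | nil => simp at ha
  | cons c' L ih =>
    obtain ⟨b, s⟩ := c'
    have hs := hr _ List.mem_cons_self
    have ih' := fun q i => ih q i fun c hc => hr c (List.mem_cons_of_mem _ hc)
    rw [List.map_cons, List.mem_cons] at ha
    simp only [scan]
    split_ifs with h1 h2 h3 h3
    · rcases ha with rfl | ha
      · obtain ⟨t, hst, htr, ht⟩ := h1
        have : IsDiscarded err P r p a := ⟨t, hs.trans_lt hst, htr, ht⟩
        exact Or.inr (this.mono (scan_value_le _ _ _))
      · exact ih' p j ha
    all_goals
      rw [List.map_cons, List.mem_cons]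
      rcases ha with ha | ha
      · exact Or.inl (Or.inl ha)
    · exact Or.inl (Or.inr ha)
    · exact (ih' _ _ ha).imp_left Or.inr
    · exact Or.inl (Or.inr ha)
    · exact (ih' _ _ ha).imp_left Or.inr

/-- What the pruned dynamic program guarantees about its values `P` and left boundaries `J` up to
the right boundary `n`, without any assumption on the errors: `P b` is the value obtained with the
last left boundary `J b`, and a left boundary `a` is beaten by `J b` unless one of the two pruning
rules has excluded it. -/
structure DPSpec (err : ℕ → ℕ → ℝ) (γ : ℝ) (P : ℕ → ℝ) (J : ℕ → ℕ) (n : ℕ) : Prop where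
  lt : ∀ b, 1 ≤ b → b ≤ n → J b < b
  value : ∀ b, 1 ≤ b → b ≤ n →
    P b = if J b = 0 then err 0 b else P (J b) + γ + err (J b) b
  le_single : ∀ b, 1 ≤ b → b ≤ n → P b ≤ err 0 b
  le_or : ∀ a b, 1 ≤ a → a < b → b ≤ n → P b ≤ P a + γ + err a b ∨
    (∃ l, a < l ∧ l < b ∧ P b < err l b + γ) ∨ ∃ t, a < t ∧ t ≤ b ∧ P t ≤ P a + err a t

/-- The invariant of the outer loop of the dynamic program. -/
structure DPInvariant (err : ℕ → ℕ → ℝ) (γ : ℝ) (s : DPState) (n : ℕ) : Prop where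
  spec : DPSpec err γ s.P s.J n
  sorted : (s.L.map Prod.fst).Pairwise (· > ·)
  mem : ∀ c ∈ s.L, 1 ≤ c.1 ∧ c.1 ≤ n ∧ c.1 ≤ c.2
  survives_or : ∀ a, 1 ≤ a → a ≤ n →
    a ∈ s.L.map Prod.fst ∨ ∃ t, a < t ∧ t ≤ n ∧ s.P t ≤ s.P a + err a t

lemma dpInvariant_init (h1 : err 0 1 = 0) :
    DPInvariant err γ { P := fun _ => 0, J := fun _ => 0, L := [(1, 2)] } 1 where
  spec :=
    { lt := fun b hb _ => hb
      value := fun b hb hb' => by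
        obtain rfl : b = 1 := le_antisymm hb' hb
        simp [h1]
      le_single := fun b hb hb' => by
        obtain rfl : b = 1 := le_antisymm hb' hb
        simp [h1]
      le_or := fun a b ha hab hb => by omega }
  sorted := by simp
  mem := by simp
  survives_or := fun a ha ha' => Or.inl (by simp; omega)

lemma DPInvariant.step {s : DPState} {n : ℕ} (h : DPInvariant err γ s n) :
    DPInvariant err γ (dpStep err γ s (n + 1)) (n + 1) := by
  set out := scan err γ s.P (n + 1) s.L (err 0 (n + 1)) 0 with hout
  have hPn : (dpStep err γ s (n + 1)).P (n + 1) = out.2.1 := Function.update_self ..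
  have hJn : (dpStep err γ s (n + 1)).J (n + 1) = out.2.2 := Function.update_self ..
  have hP : ∀ b, b ≤ n → (dpStep err γ s (n + 1)).P b = s.P b := fun b hb =>
    Function.update_of_ne (by omega) _ _
  have hJ : ∀ b, b ≤ n → (dpStep err γ s (n + 1)).J b = s.J b := fun b hb =>
    Function.update_of_ne (by omega) _ _
  have hLout : (dpStep err γ s (n + 1)).L = (n + 1, n + 1 + 1) :: out.1 := rfl
  have hdisc : ∀ a, 1 ≤ a → IsDiscarded err s.P (n + 1) out.2.1 a →
      ∃ t, a < t ∧ t ≤ n + 1 ∧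
        (dpStep err γ s (n + 1)).P t ≤ (dpStep err γ s (n + 1)).P a + err a t := by
    rintro a - ⟨t, hat, htr, ht⟩
    refine ⟨t, hat, htr, ?_⟩
    rw [hP a (by omega)]
    split_ifs at ht with h'
    · subst h'
      rwa [hPn]
    · rwa [hP t (by omega)]
  have hmemlt : ∀ c ∈ s.L, c.1 ≤ c.2 ∧ c.1 < n + 1 := fun c hc =>
    ⟨(h.mem c hc).2.2, Nat.lt_succ_of_le (h.mem c hc).2.1⟩
  have hback : out.2 = (err 0 (n + 1), 0) ∨ ∃ c ∈ s.L,
      out.2 = (s.P c.1 + γ + err c.1 (n + 1), c.1) := scan_boundary _ _ _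
  have hfst : ∀ a ∈ out.1.map Prod.fst, ∃ c ∈ s.L, c.1 = a := fun a ha =>
    List.mem_map.1 ((scan_sublist _ _ _).subset ha)
  refine ⟨⟨?_, ?_, ?_, ?_⟩, ?_, ?_, ?_⟩
  · intro b hb hbn
    rcases Nat.lt_succ_iff_lt_or_eq.1 (Nat.lt_succ_of_le hbn) with hb' | rfl
    · rw [hJ b (by omega)]
      exact h.spec.lt b hb (by omega)
    · rw [hJn]
      rcases hback with h' | ⟨c, hc, h'⟩ <;> rw [h']
      · exact hb
      · exact (hmemlt c hc).2
  · intro b hb hbn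
    rcases Nat.lt_succ_iff_lt_or_eq.1 (Nat.lt_succ_of_le hbn) with hb' | rfl
    · have := h.spec.lt b hb (by omega)
      rw [hJ b (by omega), hP b (by omega), hP _ (by omega)]
      exact h.spec.value b hb (by omega)
    · rw [hJn, hPn]
      rcases hback with h' | ⟨c, hc, h'⟩ <;> rw [h']
      · simp
      · have hcm := h.mem c hc
        rw [if_neg (by simp only; omega), hP _ hcm.2.1]
  · intro b hb hbn
    rcases Nat.lt_succ_iff_lt_or_eq.1 (Nat.lt_succ_of_le hbn) with hb' | rfl
    · rw [hP b (by omega)]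
      exact h.spec.le_single b hb (by omega)
    · rw [hPn]
      exact scan_value_le _ _ _
  · intro a b ha hab hbn
    rcases Nat.lt_succ_iff_lt_or_eq.1 (Nat.lt_succ_of_le hbn) with hb' | rfl
    · rw [hP b (by omega), hP a (by omega)]
      refine (h.spec.le_or a b ha hab (by omega)).imp_right (Or.imp_right ?_)
      rintro ⟨t, hat, htb, ht⟩
      exact ⟨t, hat, htb, by rwa [hP t (by omega)]⟩
    · rcases h.survives_or a ha (by omega) with ha' | ⟨t, hat, htn, ht⟩
      · obtain ⟨c, hc, rfl⟩ := List.mem_map.1 ha'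
        have := scan_le_or (err := err) (γ := γ) (P := s.P) (err 0 (n + 1)) 0 h.sorted hmemlt hc
        rw [← hout] at this
        rw [hPn, hP c.1 (by omega)]
        refine this.imp_right (Or.imp_right fun hd => ?_)
        have := hdisc _ ha hd
        rwa [hP c.1 (by omega)] at this
      · refine Or.inr (Or.inr ⟨t, hat, by omega, ?_⟩)
        rwa [hP t htn, hP a (by omega)]
  · rw [hLout, List.map_cons, List.pairwise_cons]
    refine ⟨fun a ha => ?_, h.sorted.sublist (scan_sublist _ _ _)⟩
    obtain ⟨c, hc, rfl⟩ := hfst a ha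
    exact (hmemlt c hc).2
  · intro c hc
    rw [hLout, List.mem_cons] at hc
    rcases hc with rfl | hc
    · simp
    · obtain ⟨c', hc', heq⟩ := hfst c.1 (List.mem_map_of_mem hc)
      have h1 := h.mem c' hc'
      rw [heq] at h1
      refine ⟨h1.1, by omega, ?_⟩
      rcases scan_mem hc with h2 | h2
      · exact (h.mem c h2).2.2
      · omega
  · intro a ha han
    rw [hLout, List.map_cons, List.mem_cons]
    rcases Nat.lt_succ_iff_lt_or_eq.1 (Nat.lt_succ_of_le han) with ha' | rfl
    · rcases h.survives_or a ha (by omega) with hs | ⟨t, hat, htn, ht⟩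
      · rcases scan_survives_or (err := err) (γ := γ) (P := s.P) (r := n + 1) (err 0 (n + 1)) 0
          (fun c hc => (hmemlt c hc).1) hs with h' | h'
        · exact Or.inl (Or.inr h')
        · exact Or.inr (hdisc a ha h')
      · refine Or.inr ⟨t, hat, by omega, ?_⟩
        rwa [hP t htn, hP a (by omega)]
    · exact Or.inl (Or.inl rfl)

lemma dpSpec_runDP (h1 : err 0 1 = 0) {N : ℕ} (hN : 1 ≤ N) :
    DPSpec err γ (runDP err γ N).P (runDP err γ N).J N := by
  have key : ∀ m, DPInvariant err γ ((List.range' 2 m).foldl (dpStep err γ)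
      { P := fun _ => 0, J := fun _ => 0, L := [(1, 2)] }) (m + 1) := by
    intro m
    induction m with
    | zero => exact dpInvariant_init h1
    | succ m ih =>
      rw [List.range'_1_concat, List.foldl_append, show 2 + m = m + 1 + 1 by omega]
      exact ih.step
  have := (key (N - 1)).spec
  rwa [Nat.sub_add_cancel hN] at this

end

/-! ### Tilings: partitions as lists of adjacent intervals -/

/-- `Tiles a b l`: the list `l` consists of the intervals of a partition of `(a, b)`, from right
to left, which is the order of `recoverSegments`. -/
inductive Tiles (a : ℕ) : ℕ → List (ℕ × ℕ) → Prop
  | nil : Tiles a a []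
  | cons {c b : ℕ} {l : List (ℕ × ℕ)} : c < b → Tiles a c l → Tiles a b ((c, b) :: l)

namespace Tiles

variable {a b c : ℕ} {l l' : List (ℕ × ℕ)}

lemma le (h : Tiles a b l) : a ≤ b := by
  induction h with
  | nil => exact le_rfl
  | cons hcb _ ih => omega

lemma append (h' : Tiles c b l') (h : Tiles a c l) : Tiles a b (l' ++ l) := by
  induction h' with
  | nil => exact h
  | cons hcb _ ih => exact .cons hcb ih

lemma single (h : a < b) : Tiles a b [(a, b)] := .cons h .nil

lemma eq_nil (h : Tiles a a l) : l = [] := by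
  cases h with
  | nil => rfl
  | cons hcb h => exact absurd h.le (not_le.2 hcb)

lemma mem (h : Tiles a b l) {p : ℕ × ℕ} (hp : p ∈ l) : a ≤ p.1 ∧ p.1 < p.2 ∧ p.2 ≤ b := by
  induction h with
  | nil => simp at hp
  | cons hcb h ih =>
    have := h.le
    rcases List.mem_cons.1 hp with rfl | hp
    · exact ⟨this, hcb, le_rfl⟩
    · have := ih hp
      omega

lemma existsUnique (h : Tiles a b l) {n : ℕ} (han : a ≤ n) (hnb : n < b) :
    ∃! p, p ∈ l ∧ p.1 ≤ n ∧ n < p.2 := by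
  induction h with
  | nil => omega
  | @cons c b l hcb h ih =>
    rcases lt_or_ge n c with hn | hn
    · obtain ⟨p, ⟨hp, hpn⟩, huniq⟩ := ih hn
      refine ⟨p, ⟨List.mem_cons_of_mem _ hp, hpn⟩, ?_⟩
      rintro q ⟨hq, hqn⟩
      rcases List.mem_cons.1 hq with rfl | hq
      · exact absurd hqn.1 (not_le.2 hn)
      · exact huniq q ⟨hq, hqn⟩
    · refine ⟨(c, b), ⟨List.mem_cons_self, hn, hnb⟩, ?_⟩
      rintro q ⟨hq, hqn⟩
      rcases List.mem_cons.1 hq with rfl | hq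
      · rfl
      · have := h.mem hq
        omega

lemma nodup (h : Tiles a b l) : l.Nodup := by
  induction h with
  | nil => exact List.nodup_nil
  | cons hcb h ih =>
    refine List.nodup_cons.2 ⟨fun hmem => ?_, ih⟩
    have := h.mem hmem
    simp only at this
    omega

/-- The partition given by a tiling of the whole domain. -/
def toPartition {N : ℕ} (h : Tiles 0 N l) : IntervalPartition N where
  parts := l.toFinset
  valid := fun p hp => (h.mem (List.mem_toFinset.1 hp)).2
  cover := fun n hn => by simpa using h.existsUnique n.zero_le hn

lemma mem_toPartition {N : ℕ} (h : Tiles 0 N l) {p : ℕ × ℕ} :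
    p ∈ h.toPartition.parts ↔ p ∈ l := List.mem_toFinset

lemma size_toPartition {N : ℕ} (h : Tiles 0 N l) : h.toPartition.size = l.length :=
  List.toFinset_card_of_nodup h.nodup

lemma sum_toPartition {N : ℕ} (h : Tiles 0 N l) (w : ℕ → ℕ → ℝ) :
    ∑ p ∈ h.toPartition.parts, w p.1 p.2 = (l.map fun p => w p.1 p.2).sum :=
  List.sum_toFinset _ h.nodup

lemma exists_singletons (h : a ≤ b) : ∃ l, Tiles a b l ∧ ∀ p ∈ l, p.2 - p.1 = 1 := by
  induction b, h using Nat.le_induction with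
  | base => exact ⟨[], .nil, by simp⟩
  | succ b _ ih =>
    obtain ⟨l, hl, h1⟩ := ih
    exact ⟨(b, b + 1) :: l, .cons b.lt_succ_self hl, by simpa using h1⟩

end Tiles

/-- Every partition comes from a tiling. -/
lemma IntervalPartition.exists_tiles {N : ℕ} (I : IntervalPartition N) :
    ∃ (l : List (ℕ × ℕ)) (h : Tiles 0 N l), h.toPartition.parts = I.parts := by
  have key : ∀ m, (m = 0 ∨ ∃ p ∈ I.parts, p.2 = m) →
      ∃ l, Tiles 0 m l ∧ ∀ p, p ∈ l ↔ p ∈ I.parts ∧ p.2 ≤ m := by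
    intro m
    induction m using Nat.strong_induction_on with
    | _ m ih =>
      rintro (rfl | ⟨p, hp, rfl⟩)
      · refine ⟨[], .nil, fun p => ⟨by simp, fun h => ?_⟩⟩
        have := (I.valid p h.1).1
        omega
      · have hpv := I.valid p hp
        obtain ⟨l, hl, hmem⟩ := ih p.1 hpv.1 (by
          rcases Nat.eq_zero_or_pos p.1 with h0 | h0
          · exact Or.inl h0
          · obtain ⟨q, ⟨hq, hqn⟩, -⟩ := I.cover (p.1 - 1) (by omega)
            refine Or.inr ⟨q, hq, ?_⟩
            by_contra hne
            have hqp := I.eq_of_mem hq hp (n := p.1) (by omega) (by omega)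
            subst hqp
            omega)
        refine ⟨p :: l, .cons hpv.1 hl, fun q => ?_⟩
        rw [List.mem_cons, hmem]
        constructor
        · rintro (rfl | ⟨hq, hq'⟩)
          · exact ⟨hp, le_rfl⟩
          · exact ⟨hq, by omega⟩
        · rintro ⟨hq, hq'⟩
          by_cases hqp : q.2 ≤ p.1
          · exact Or.inr ⟨hq, hqp⟩
          · have := I.valid q hq
            exact Or.inl (I.eq_of_mem hq hp (n := q.2 - 1) (by omega) (by omega))
  obtain ⟨l, hl, hmem⟩ := key N (by
    rcases Nat.eq_zero_or_pos N with h0 | h0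
    · exact Or.inl h0
    · obtain ⟨q, ⟨hq, hqn⟩, -⟩ := I.cover (N - 1) (by omega)
      have := I.valid q hq
      exact Or.inr ⟨q, hq, by omega⟩)
  refine ⟨l, hl, Finset.ext fun p => ?_⟩
  rw [hl.mem_toPartition, hmem]
  exact ⟨fun h => h.1, fun h => ⟨h, (I.valid p h).2⟩⟩

/-- The energy of a tiling, for interval errors `w` and jump penalty `γ`. -/
def tilingCost (w : ℕ → ℕ → ℝ) (γ : ℝ) (l : List (ℕ × ℕ)) : ℝ :=
  (l.map fun p => w p.1 p.2).sum + γ * l.length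

section

variable {w : ℕ → ℕ → ℝ} {γ : ℝ}

lemma tilingCost_nil : tilingCost w γ [] = 0 := by simp [tilingCost]

lemma tilingCost_cons (p : ℕ × ℕ) (l : List (ℕ × ℕ)) :
    tilingCost w γ (p :: l) = w p.1 p.2 + γ + tilingCost w γ l := by
  simp only [tilingCost, List.map_cons, List.sum_cons, List.length_cons]
  push_cast
  ring

lemma tilingCost_append (l l' : List (ℕ × ℕ)) :
    tilingCost w γ (l ++ l') = tilingCost w γ l + tilingCost w γ l' := by
  simp only [tilingCost, List.map_append, List.sum_append, List.length_append]
  push_cast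
  ring

end

/-! ### The pruned dynamic program on approximate errors -/

section

variable {J : ℕ → ℕ} {P : ℕ → ℝ} {err : ℕ → ℕ → ℝ} {γ : ℝ} {N : ℕ}

lemma DPSpec.tiles_recoverSegments (hP : DPSpec err γ P J N) (m : ℕ) {r : ℕ} (hrm : r ≤ m)
    (hrN : r ≤ N) : Tiles 0 r (recoverSegments J m r) := by
  induction m generalizing r with
  | zero =>
    obtain rfl : r = 0 := by omega
    exact .nil
  | succ m ih =>
    rw [recoverSegments]
    split_ifs with h0
    · subst h0
      exact .nil
    · have := hP.lt r (by omega) hrN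
      exact .cons this (ih (by omega) (by omega))

/-- The values of the dynamic program do not count the first interval. -/
lemma DPSpec.tilingCost_recoverSegments (hP : DPSpec err γ P J N) (m : ℕ) {r : ℕ} (hr : 1 ≤ r)
    (hrm : r ≤ m) (hrN : r ≤ N) : tilingCost err γ (recoverSegments J m r) = P r + γ := by
  induction m generalizing r with
  | zero => omega
  | succ m ih =>
    have hlt := hP.lt r hr hrN
    rw [recoverSegments, if_neg (by omega), tilingCost_cons, hP.value r hr hrN]
    split_ifs with h0
    · rw [h0]
      cases m <;> simp [recoverSegments, tilingCost_nil]
    · rw [ih (by omega) (by omega) (by omega)]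
      ring

lemma DPSpec.boundary_eq_of_mem (hP : DPSpec err γ P J N) {m a r : ℕ} (hr : 1 ≤ r)
    (hrm : r ≤ m) (hrN : r ≤ N) (h : (a, r) ∈ recoverSegments J m r) : J r = a := by
  cases m with
  | zero => omega
  | succ m =>
    have hlt := hP.lt r hr hrN
    rw [recoverSegments, if_neg (by omega), List.mem_cons] at h
    rcases h with h | h
    · simpa using (congrArg Prod.fst h).symm
    · have := ((hP.tiles_recoverSegments m (by omega) (by omega)).mem h).2.2
      simp only at this
      omega

/-- Interval errors `err` that approximate exact errors `ex`: on every tiling of a subinterval of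
`(0, N)` the sums differ by at most `η`. The exact errors are superadditive; neither monotonicity
nor superadditivity of `err` is assumed. -/
structure ApproxErrors (err ex : ℕ → ℕ → ℝ) (N k : ℕ) (η : ℝ) : Prop where
  nonneg : ∀ a b, 0 ≤ err a b
  exact_nonneg : ∀ a b, 0 ≤ ex a b
  short : ∀ a b, b - a ≤ k → err a b = 0
  add_le : ∀ a t b, a ≤ t → t ≤ b → b ≤ N → ex a t + ex t b ≤ ex a b
  close : ∀ (γ : ℝ) (a b : ℕ) (l : List (ℕ × ℕ)), Tiles a b l → b ≤ N →
    |tilingCost err γ l - tilingCost ex γ l| ≤ η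

lemma ApproxErrors.mono {ex : ℕ → ℕ → ℝ} {k : ℕ} {η : ℝ} (h : ApproxErrors err ex N k η)
    {a t b : ℕ} (hat : a ≤ t) (htb : t ≤ b) (hb : b ≤ N) : ex t b ≤ ex a b :=
  (le_add_of_nonneg_left (h.exact_nonneg a t)).trans (h.add_le a t b hat htb hb)

lemma ApproxErrors.close_single {ex : ℕ → ℕ → ℝ} {k : ℕ} {η : ℝ}
    (h : ApproxErrors err ex N k η) {a b : ℕ} (hab : a < b) (hb : b ≤ N) :
    err a b ≤ ex a b + η := by
  have := (abs_le.1 (h.close 0 a b _ (Tiles.single hab) hb)).2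
  simp only [tilingCost, List.map_cons, List.map_nil, List.sum_cons, List.sum_nil] at this
  linarith

lemma DPSpec.value_nonneg (hP : DPSpec err γ P J N) (hγ : 0 ≤ γ) (herr : ∀ a b, 0 ≤ err a b)
    {r : ℕ} (hr : 1 ≤ r) (hrN : r ≤ N) : 0 ≤ P r := by
  induction r using Nat.strong_induction_on with
  | _ r ih =>
    have hlt := hP.lt r hr hrN
    rw [hP.value r hr hrN]
    split_ifs with h0
    · exact herr _ _
    · have := ih (J r) hlt (by omega) (by omega)
      have := herr (J r) r
      linarith

/-- On short intervals the computed errors vanish exactly, and pruning loses nothing. -/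
lemma DPSpec.value_le_of_short {ex : ℕ → ℕ → ℝ} {k : ℕ} {η : ℝ} (hP : DPSpec err γ P J N)
    (hγ : 0 ≤ γ) (h : ApproxErrors err ex N k η) {r : ℕ} (hrN : r ≤ N) (a : ℕ) (ha : 1 ≤ a)
    (har : a < r) (hk : r - a ≤ k) : P r ≤ P a + γ := by
  induction hd : r - a using Nat.strong_induction_on generalizing a with
  | _ d ih =>
    have h0 := hP.value_nonneg hγ h.nonneg ha (by omega)
    rcases hP.le_or a r ha har hrN with h1 | ⟨l, hal, hlr, h1⟩ | ⟨t, hat, htr, h1⟩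
    · rwa [h.short a r hk, add_zero] at h1
    · rw [h.short l r (by omega)] at h1
      linarith
    · rw [h.short a t (by omega), add_zero] at h1
      rcases htr.eq_or_lt with rfl | htr
      · linarith
      · have := ih (r - t) (by omega) t (by omega) htr (by omega) rfl
        linarith

variable {ex : ℕ → ℕ → ℝ} {k : ℕ} {η G : ℝ}

/-- Suppose that all tilings whose exact energy is within `2 η` of `G` have the same long
intervals. Then the values of the dynamic program are at most the computed energies of the initial
pieces of every tiling of exact energy at most `G`: if a pruning rule had removed a long interval
of such a tiling, then exchanging its initial piece would give a tiling of exact energy at most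
`G + 2 η` that lacks this long interval. -/
lemma DPSpec.value_add_le_tilingCost (hP : DPSpec err γ P J N) (hγ : 0 ≤ γ) (hη : 0 ≤ η)
    (h : ApproxErrors err ex N k η)
    (hG : ∀ l l', Tiles 0 N l → Tiles 0 N l' → tilingCost ex γ l ≤ G + 2 * η →
      tilingCost ex γ l' ≤ G + 2 * η → ∀ p ∈ l, k < p.2 - p.1 → p ∈ l')
    {r : ℕ} {l₁ : List (ℕ × ℕ)} (h₁ : Tiles 0 r l₁) (hr : 1 ≤ r) (hrN : r ≤ N)
    {l₂ : List (ℕ × ℕ)} (h₂ : Tiles r N l₂) (hl : tilingCost ex γ (l₂ ++ l₁) ≤ G) :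
    P r + γ ≤ tilingCost err γ l₁ := by
  induction h₁ generalizing l₂ with
  | nil => omega
  | @cons a r l har h₁ ih =>
    have hlong : k < r - a → ∀ l', Tiles 0 N l' → tilingCost ex γ l' ≤ G + 2 * η →
        (a, r) ∈ l' := fun hk l' hl' hcost =>
      hG _ l' (h₂.append (.cons har h₁)) hl' (by linarith) hcost (a, r) (by simp) hk
    rw [tilingCost_append, tilingCost_cons] at hl
    rw [tilingCost_cons]
    simp only at hl ⊢
    rcases Nat.eq_zero_or_pos a with rfl | ha
    · rw [h₁.eq_nil, tilingCost_nil]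
      have := hP.le_single r hr hrN
      linarith
    have ih' : P a + γ ≤ tilingCost err γ l := by
      refine ih ha (by omega) (h₂.append (Tiles.single har)) ?_
      rw [tilingCost_append, tilingCost_append, tilingCost_cons, tilingCost_nil]
      simp only
      linarith
    by_cases hk : r - a ≤ k
    · have := hP.value_le_of_short hγ h hrN a ha har hk
      rw [h.short a r hk]
      linarith
    rw [not_le] at hk
    rcases hP.le_or a r ha har hrN with h1 | ⟨t, hat, htr, h1⟩ | ⟨t, hat, htr, h1⟩
    · linarith
    · have hQ := hP.tiles_recoverSegments N hrN hrN
      have hQcost := hP.tilingCost_recoverSegments N hr hrN hrN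
      have hQclose := abs_le.1 (h.close γ 0 r _ hQ hrN)
      have h3 := h.close_single htr hrN
      have h4 := h.mono hat.le htr.le hrN
      -- The tiling `l` is nonempty, hence its cost is at least `γ`.
      have h5 : γ ≤ tilingCost ex γ l := by
        cases h₁ with
        | nil => omega
        | @cons c a l' hca h₁' =>
          rw [tilingCost_cons, tilingCost]
          have h6 := h.exact_nonneg c a
          have h7 : 0 ≤ (l'.map fun p => ex p.1 p.2).sum :=
            List.sum_nonneg (by simpa using fun x a b _ hx => hx ▸ h.exact_nonneg a b)
          have h8 : 0 ≤ γ * (l'.length : ℝ) := by positivity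
          simp only
          linarith
      have hmem := hlong hk _ (h₂.append hQ) (by rw [tilingCost_append]; linarith)
      rw [List.mem_append] at hmem
      have hJ : J r = a := by
        refine hP.boundary_eq_of_mem hr hrN hrN (hmem.resolve_left fun hmem => ?_)
        have := h₂.mem hmem
        simp only at this
        omega
      rw [hP.value r hr hrN, hJ, if_neg (by omega)]
      linarith
    · rcases htr.eq_or_lt with rfl | htr
      · linarith
      exfalso
      have hQ := hP.tiles_recoverSegments N (r := t) (by omega) (by omega)
      have hQcost := hP.tilingCost_recoverSegments N (r := t) (by omega) (by omega) (by omega)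
      have hQclose := abs_le.1 (h.close γ 0 t _ hQ (by omega))
      have hlt_close := abs_le.1 (h.close γ 0 t _ (.cons hat h₁) (by omega))
      have h4 := h.add_le a t r hat.le htr.le hrN
      rw [tilingCost_cons, tilingCost_cons] at hlt_close
      simp only at hlt_close
      have hmem := hlong hk _ (h₂.append (.cons htr hQ)) (by
        rw [tilingCost_append, tilingCost_cons]
        simp only
        linarith)
      rw [List.mem_append, List.mem_cons] at hmem
      rcases hmem with hmem | hmem | hmem
      · have := h₂.mem hmem
        simp only at this
        omega
      · have := congrArg Prod.fst hmem
        simp only at this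
        omega
      · have := hQ.mem hmem
        simp only at this
        omega

/-- The tiling found by the dynamic program has nearly minimal exact energy. -/
lemma DPSpec.tilingCost_recoverSegments_le (hP : DPSpec err γ P J N) (hN : 1 ≤ N) (hγ : 0 ≤ γ)
    (hη : 0 ≤ η) (h : ApproxErrors err ex N k η)
    (hG : ∀ l l', Tiles 0 N l → Tiles 0 N l' → tilingCost ex γ l ≤ G + 2 * η →
      tilingCost ex γ l' ≤ G + 2 * η → ∀ p ∈ l, k < p.2 - p.1 → p ∈ l')
    {l : List (ℕ × ℕ)} (hl : Tiles 0 N l) (hlG : tilingCost ex γ l ≤ G) :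
    tilingCost ex γ (recoverSegments J N N) ≤ G + 2 * η := by
  have h1 := hP.value_add_le_tilingCost hγ hη h hG hl hN le_rfl .nil (by simpa using hlG)
  have h2 := hP.tilingCost_recoverSegments N hN le_rfl le_rfl
  have h3 := abs_le.1 (h.close γ 0 N _ (hP.tiles_recoverSegments N le_rfl le_rfl) le_rfl)
  have h4 := abs_le.1 (h.close γ 0 N l hl le_rfl)
  linarith

end

/-! ### Computed errors -/

section

variable {τ : ℝ} {M : MachineArith τ} {k : ℕ} {β : ℝ≥0∞}

lemma MachineArith.add_nonneg (M : MachineArith τ) (hτ : τ ≤ 1) {x y : ℝ} (h : 0 ≤ x + y) :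
    0 ≤ M.add x y := by
  have h1 := (abs_le.1 (M.add_err x y)).1
  rw [abs_of_nonneg h] at h1
  nlinarith

lemma MachineArith.mul_self_nonneg (M : MachineArith τ) (hτ : τ ≤ 1) (x : ℝ) :
    0 ≤ M.mul x x := by
  have h1 := (abs_le.1 (M.mul_err x x)).1
  rw [abs_of_nonneg (_root_.mul_self_nonneg x)] at h1
  nlinarith [_root_.mul_self_nonneg x]

lemma foldl_rotate_error (L : List ℕ) (s : QRState × PendingRow) :
    (L.foldl (rotate M) s).1.E = s.1.E := by
  induction L generalizing s with
  | nil => rfl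
  | cons j L ih => exact ih _

lemma polyStep_error_of_lt {s : QRState} {r : ℕ} (y : ℝ) (h : r < k) :
    (polyStep M k s r y).E = s.E := by
  rw [polyStep]
  simp only [if_pos h]
  exact foldl_rotate_error _ _

lemma splineStep_error_of_lt {b : ℝ} {s : QRState} {r : ℕ} (y : ℝ) (h : r < k) :
    (splineStep M k b s r y).E = s.E := by
  rw [splineStep]
  simp only [if_pos h]

lemma updateError_nonneg (hτ : τ ≤ 1) {s : QRState × PendingRow} (hs : 0 ≤ s.1.E) :
    0 ≤ (updateError M s).E :=
  M.add_nonneg hτ (add_nonneg hs (M.mul_self_nonneg hτ _))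

lemma polyStep_error_nonneg (hτ : τ ≤ 1) {s : QRState} (hs : 0 ≤ s.E) (r : ℕ) (y : ℝ) :
    0 ≤ (polyStep M k s r y).E := by
  by_cases h : r < k
  · rwa [polyStep_error_of_lt y h]
  · rw [polyStep]
    simp only [if_neg h]
    exact updateError_nonneg hτ (by rwa [foldl_rotate_error])

lemma splineStep_error_nonneg (hτ : τ ≤ 1) {b : ℝ} {s : QRState} (hs : 0 ≤ s.E) (r : ℕ) (y : ℝ) :
    0 ≤ (splineStep M k b s r y).E := by
  by_cases h : r < k
  · rwa [splineStep_error_of_lt y h]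
  · rw [splineStep]
    simp only [if_neg h]
    exact updateError_nonneg hτ (by rwa [foldl_rotate_error])

lemma computedError_nonneg (hτ : τ ≤ 1) {n : ℕ} (x : EuclideanSpace ℝ (Fin n)) :
    0 ≤ computedError M k β x := by
  refine List.foldlRecOn (motive := fun s : QRState => 0 ≤ s.E) _ _ le_rfl fun s hs r _ => ?_
  split_ifs
  · exact polyStep_error_nonneg hτ hs _ _
  · exact splineStep_error_nonneg hτ hs _ _

lemma computedError_eq_zero {n : ℕ} (h : n ≤ k) (x : EuclideanSpace ℝ (Fin n)) :
    computedError M k β x = 0 := by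
  refine List.foldlRecOn (motive := fun s : QRState => s.E = 0) _ _ rfl fun s hs r hr => ?_
  have hrk : r < k := (List.mem_range.1 hr).trans_le h
  split_ifs
  · rwa [polyStep_error_of_lt _ hrk]
  · rwa [splineStep_error_of_lt _ hrk]

end

/-! ### The computed segments -/

section

variable {τ : ℝ} {k : ℕ} {β : ℝ≥0∞} {γ : ℝ} {N : ℕ}

lemma classEnergy_toPartition_le (hγ : 0 ≤ γ) (f : EuclideanSpace ℝ (Fin N))
    {l : List (ℕ × ℕ)} (hl : Tiles 0 N l) :
    classEnergy k β γ f hl.toPartition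
      ≤ tilingCost (fun a b => segmentError k β (segment f a b)) γ l := by
  rw [classEnergy, tilingCost,
    ← hl.sum_toPartition (fun a b => segmentError k β (segment f a b)), ← hl.size_toPartition]
  have : γ * (hl.toPartition.classSize k : ℝ) ≤ γ * hl.toPartition.size :=
    mul_le_mul_of_nonneg_left (by exact_mod_cast hl.toPartition.classSize_le_size) hγ
  linarith

lemma abs_computedEnergy_sub_le {C η : ℝ} (hη : 0 ≤ η)
    (hg : energyErrorBound τ k β γ C N ≤ ENNReal.ofReal η) (M : MachineArith τ)
    {f : EuclideanSpace ℝ (Fin N)} (hf : ‖f‖ < C) (I : IntervalPartition N) :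
    |computedEnergy M k β γ f I - classEnergy k β γ f I| ≤ η := by
  rw [← ENNReal.ofReal_le_ofReal_iff hη]
  refine le_trans ?_ hg
  exact le_iSup_of_le M (le_iSup_of_le f (le_iSup_of_le hf (le_iSup_of_le I le_rfl)))

/-- The bound for whole partitions carries over to tilings of subintervals, which are completed by
intervals of length one; these have error zero, exactly as well as computed. -/
lemma approxErrors_computedError (hk : 1 ≤ k) (hτ : τ ≤ 1) {C η : ℝ} (hη : 0 ≤ η)
    (hg : energyErrorBound τ k β γ C N ≤ ENNReal.ofReal η) (M : MachineArith τ)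
    {f : EuclideanSpace ℝ (Fin N)} (hf : ‖f‖ < C) :
    ApproxErrors (fun a b => computedError M k β (segment f a b))
      (fun a b => segmentError k β (segment f a b)) N k η where
  nonneg a b := computedError_nonneg hτ _
  exact_nonneg a b := segmentError_nonneg _
  short a b h := computedError_eq_zero h _
  add_le a t b hat htb hb := segmentError_add_le_segmentError f hat htb hb
  close γ' a b l hl hb := by
    obtain ⟨l₁, hl₁, h₁⟩ := Tiles.exists_singletons (Nat.zero_le a)
    obtain ⟨l₂, hl₂, h₂⟩ := Tiles.exists_singletons hb
    have hT := (hl₂.append hl).append hl₁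
    have h := abs_computedEnergy_sub_le hη hg M hf hT.toPartition
    have hzero : ∀ (w : ℕ → ℕ → ℝ), (∀ p : ℕ × ℕ, p.2 - p.1 ≤ k → w p.1 p.2 = 0) →
        ∀ l' : List (ℕ × ℕ), (∀ p ∈ l', p.2 - p.1 = 1) →
          (l'.map fun p => w p.1 p.2).sum = 0 := by
      intro w hw l' hl'
      refine List.sum_eq_zero fun x hx => ?_
      obtain ⟨p, hp, rfl⟩ := List.mem_map.1 hx
      exact hw p ((hl' p hp).trans_le hk)
    have hc := hzero (fun a b => computedError M k β (segment f a b))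
      fun p hp => computedError_eq_zero hp _
    have he := hzero (fun a b => segmentError k β (segment f a b))
      fun p hp => segmentError_eq_zero hp _
    rw [computedEnergy, classEnergy,
      hT.sum_toPartition (fun a b => computedError M k β (segment f a b)),
      hT.sum_toPartition (fun a b => segmentError k β (segment f a b))] at h
    simp only [List.map_append, List.sum_append, hc l₁ h₁, hc l₂ h₂, he l₁ h₁, he l₂ h₂] at h
    rw [tilingCost, tilingCost]
    convert h using 2
    ring

/-- The algorithm finds a partition in the class of strictly least energy. -/
lemma exists_tiles_computedSegments (hk : 1 ≤ k) (hγ : 0 ≤ γ) (hτ : τ ≤ 1) {C ε : ℝ}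
    (hε : 0 < ε) (hg : energyErrorBound τ k β γ C N ≤ ENNReal.ofReal (ε / 4))
    (M : MachineArith τ) {f : EuclideanSpace ℝ (Fin N)} (hf : ‖f‖ < C) {I : IntervalPartition N}
    (hI : ∀ K : IntervalPartition N, ¬ IntervalPartition.Equivalent k K I →
      classEnergy k β γ f I < classEnergy k β γ f K - ε) :
    ∃ h : Tiles 0 N (computedSegments M k β γ f),
      IntervalPartition.Equivalent k h.toPartition I := by
  rcases Nat.eq_zero_or_pos N with rfl | hN
  · refine ⟨.nil, ?_⟩
    have : ∀ K : IntervalPartition 0, K.parts = ∅ := fun K =>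
      eq_empty_of_forall_notMem fun p hp => by
        have := K.valid p hp
        omega
    rw [IntervalPartition.Equivalent, IntervalPartition.longParts, IntervalPartition.longParts,
      this, this]
  set ex : ℕ → ℕ → ℝ := fun a b => segmentError k β (segment f a b) with hex
  have happrox := approxErrors_computedError hk hτ (by positivity) hg M hf
  have hP := dpSpec_runDP (err := fun a b => computedError M k β (segment f a b)) (γ := γ)
    (computedError_eq_zero hk _) hN
  have hequiv : ∀ l (hl : Tiles 0 N l), tilingCost ex γ l ≤ classEnergy k β γ f I + 2 * (ε / 4) →
      IntervalPartition.Equivalent k hl.toPartition I := by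
    intro l hl hcost
    by_contra hne
    have h1 := hI _ hne
    have h2 := classEnergy_toPartition_le (k := k) (β := β) hγ f hl
    linarith
  obtain ⟨K, hKI, hK⟩ := I.exists_size_eq_classSize k
  obtain ⟨l, hl, hlK⟩ := K.exists_tiles
  have hlcost : tilingCost ex γ l ≤ classEnergy k β γ f I := by
    rw [tilingCost, ← hl.sum_toPartition, ← hl.size_toPartition, IntervalPartition.size, hlK,
      sum_segmentError_congr f hKI, ← IntervalPartition.size, hK, classEnergy]
  have hQ : Tiles 0 N (computedSegments M k β γ f) := hP.tiles_recoverSegments N le_rfl le_rfl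
  refine ⟨hQ, hequiv _ hQ ?_⟩
  refine hP.tilingCost_recoverSegments_le hN hγ (by positivity) happrox ?_ hl hlcost
  intro l l' hl hl' hcost hcost' p hp hpk
  have h1 : IntervalPartition.Equivalent k hl.toPartition hl'.toPartition :=
    (hequiv l hl hcost).trans (hequiv l' hl' hcost').symm
  exact hl'.mem_toPartition.1 (h1.mem_of_long (hl.mem_toPartition.2 hp) hpk)

lemma foldl_ite_eq {α : Type*} (Q : α → Prop) [DecidablePred Q] (g : α → ℝ) (l : List α)
    (x : ℝ) {p : α} (hp : p ∈ l) (hQ : Q p) (huniq : ∀ q ∈ l, Q q → q = p) :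
    l.foldl (fun acc q => if Q q then g q else acc) x = g p := by
  induction l using List.reverseRecOn with
  | nil => simp at hp
  | append_singleton l q ih =>
    rw [List.foldl_append, List.foldl_cons, List.foldl_nil]
    split_ifs with h
    · rw [huniq q (by simp) h]
    · refine ih ?_ fun q' hq' => huniq q' (by simp [hq'])
      rcases List.mem_append.1 hp with hp | hp
      · exact hp
      · rw [List.mem_singleton] at hp
        exact absurd (hp ▸ hQ) h

lemma segment_computedSignal {M : MachineArith τ} {f : EuclideanSpace ℝ (Fin N)}
    (h : Tiles 0 N (computedSegments M k β γ f)) {p : ℕ × ℕ}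
    (hp : p ∈ computedSegments M k β γ f) :
    segment (computedSignal M k β γ f) p.1 p.2 = computedFit M k β (segment f p.1 p.2) := by
  have hpm := h.mem hp
  refine ext_extend fun i hi => ?_
  have hpi : p.1 ≤ p.1 + i ∧ p.1 + i < p.2 := by omega
  have hN : p.1 + i < N := by omega
  rw [extend_segment _ hi, extend_of_lt _ hN, computedSignal]
  simp only
  rw [foldl_ite_eq (fun q : ℕ × ℕ => q.1 ≤ p.1 + i ∧ p.1 + i < q.2)
    (fun q => extend (computedFit M k β (segment f q.1 q.2)) (p.1 + i - q.1)) _ _ hp hpi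
    fun q hq hqi => (h.existsUnique (Nat.zero_le _) hN).unique ⟨hq, hqi⟩ ⟨hp, hpi⟩,
    Nat.add_sub_cancel_left]

/-! ### Backward errors -/

/-- The infimum in the definition of the backward error is attained, as the data with a given fit
form a closed set. -/
lemma exists_isSegmentFit_computedFit (M : MachineArith τ) {n : ℕ}
    (x : EuclideanSpace ℝ (Fin n)) (hfin : backwardError τ k β n ≠ ⊤) :
    ∃ y, IsSegmentFit k β y (computedFit M k β x) ∧
      ‖y - x‖ ≤ (backwardError τ k β n).toReal * ‖x‖ := by
  set v := computedFit M k β x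
  have hclosed : IsClosed {y | IsSegmentFit k β y v} := by
    simp only [IsSegmentFit, Set.ofPred_and, Set.ofPred_forall]
    exact isClosed_const.inter (isClosed_iInter fun w => isClosed_iInter fun _ =>
      isClosed_le (continuous_segmentEnergy_left v) (continuous_segmentEnergy_left w))
  obtain ⟨m₀, hm₀⟩ : {m : ℝ≥0∞ | ∀ (M : MachineArith τ) (x : EuclideanSpace ℝ (Fin n)),
      ∃ y, IsSegmentFit k β y (computedFit M k β x) ∧ ‖y - x‖ₑ ≤ m * ‖x‖ₑ}.Nonempty := by
    by_contra hne
    rw [Set.not_nonempty_iff_eq_empty] at hne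
    exact hfin (by rw [backwardError, hne, sInf_empty])
  obtain ⟨y₀, hy₀, -⟩ := hm₀ M x
  obtain ⟨y, hy, hdist⟩ := hclosed.exists_infDist_eq_dist ⟨y₀, hy₀⟩ x
  refine ⟨y, hy, ?_⟩
  have hle : ∀ z, IsSegmentFit k β z v → ‖y - x‖ ≤ ‖z - x‖ := fun z hz => by
    rw [← dist_eq_norm, ← dist_eq_norm, dist_comm, ← hdist, dist_comm]
    exact Metric.infDist_le_dist_of_mem hz
  rcases eq_or_ne x 0 with hx | hx
  · obtain ⟨z, hz, hzx⟩ := hm₀ M x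
    simp only [hx, enorm_zero, mul_zero, nonpos_iff_eq_zero, enorm_eq_zero] at hzx
    have := hle z hz
    simp only [hx, hzx, norm_zero, mul_zero] at this ⊢
    exact this
  · have hx0 : 0 < ‖x‖ := norm_pos_iff.2 hx
    rw [← div_le_iff₀ hx0, ← ENNReal.ofReal_le_iff_le_toReal hfin]
    refine le_sInf fun m hm => ?_
    obtain ⟨z, hz, hzx⟩ := hm M x
    rw [ENNReal.ofReal_div_of_pos hx0, ofReal_norm, ofReal_norm]
    refine ENNReal.div_le_of_le_mul (le_trans ?_ hzx)
    rw [← ofReal_norm, ← ofReal_norm]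
    exact ENNReal.ofReal_le_ofReal (hle z hz)

lemma deltaPartition_eq_ofReal {C : ℝ} (hC : 0 ≤ C) {I : IntervalPartition N}
    (hfin : ∀ p ∈ I.parts, backwardError τ k β (p.2 - p.1) ≠ ⊤) :
    deltaPartition τ k β C I = ENNReal.ofReal
      √(∑ p ∈ I.parts, ((backwardError τ k β (p.2 - p.1)).toReal * C) ^ 2) := by
  rw [deltaPartition, Real.sqrt_eq_rpow,
    ← ENNReal.ofReal_rpow_of_nonneg (sum_nonneg fun _ _ => sq_nonneg _) (by norm_num),
    ENNReal.ofReal_sum_of_nonneg fun _ _ => sq_nonneg _]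
  congr 1
  refine sum_congr rfl fun p hp => ?_
  rw [ENNReal.ofReal_pow (by positivity), ENNReal.ofReal_mul ENNReal.toReal_nonneg,
    ENNReal.ofReal_toReal (hfin p hp)]

lemma backwardError_ne_top {C : ℝ} (hC : 0 < C) (hδ : deltaStar τ k β C N ≠ ⊤)
    (I : IntervalPartition N) {p : ℕ × ℕ} (hp : p ∈ I.parts) :
    backwardError τ k β (p.2 - p.1) ≠ ⊤ := by
  intro htop
  have h1 : deltaPartition τ k β C I ≠ ⊤ :=
    ne_top_of_le_ne_top hδ (le_iSup (deltaPartition τ k β C) I)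
  refine h1 ?_
  have h2 : ∑ q ∈ I.parts, (backwardError τ k β (q.2 - q.1) * ENNReal.ofReal C) ^ 2 = ⊤ := by
    refine ENNReal.sum_eq_top.2 ⟨p, hp, ?_⟩
    rw [htop, ENNReal.top_mul (by simpa using hC)]
    simp
  rw [deltaPartition, h2]
  exact ENNReal.top_rpow_of_pos (by norm_num)

/-- The computed fits on a partition are the exact fits to data close to `f`. The inequality is
strict because `‖f‖ < C`, unless all backward errors vanish. -/
lemma exists_isPartitionFit_of_computedFit (M : MachineArith τ) {C : ℝ}
    {f u : EuclideanSpace ℝ (Fin N)} (hf : ‖f‖ < C) (hδ : deltaStar τ k β C N ≠ ⊤)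
    {I : IntervalPartition N}
    (hu : ∀ p ∈ I.parts, segment u p.1 p.2 = computedFit M k β (segment f p.1 p.2)) :
    ∃ f', IsPartitionFit k β f' u I ∧
      (‖f' - f‖ₑ < deltaStar τ k β C N ∨ (deltaStar τ k β C N = 0 ∧ f' = f)) := by
  have hC : 0 < C := (norm_nonneg f).trans_lt hf
  set μ : ℕ × ℕ → ℝ := fun p => (backwardError τ k β (p.2 - p.1)).toReal with hμ
  have hμ0 : ∀ p, 0 ≤ μ p := fun p => ENNReal.toReal_nonneg
  have hy : ∀ p : ℕ × ℕ, ∃ y : EuclideanSpace ℝ (Fin (p.2 - p.1)), p ∈ I.parts →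
      IsSegmentFit k β y (computedFit M k β (segment f p.1 p.2)) ∧
        ‖y - segment f p.1 p.2‖ ≤ μ p * ‖segment f p.1 p.2‖ := by
    intro p
    by_cases hp : p ∈ I.parts
    · obtain ⟨y, h⟩ :=
        exists_isSegmentFit_computedFit M (segment f p.1 p.2) (backwardError_ne_top hC hδ I hp)
      exact ⟨y, fun _ => h⟩
    · exact ⟨0, fun h => absurd h hp⟩
  choose y hy using hy
  obtain ⟨f', hf'⟩ := I.exists_segment_eq y
  refine ⟨f', fun p hp => ?_, ?_⟩
  · rw [hf' p hp, hu p hp]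
    exact (hy p hp).1
  have hdist : ∀ p ∈ I.parts, ‖segment (f' - f) p.1 p.2‖ ≤ μ p * ‖segment f p.1 p.2‖ := by
    intro p hp
    rw [segment_sub, hf' p hp]
    exact (hy p hp).2
  have hsegC : ∀ p ∈ I.parts, ‖segment f p.1 p.2‖ < C := by
    intro p hp
    refine lt_of_le_of_lt ?_ hf
    refine le_of_sq_le_sq ?_ (norm_nonneg f)
    rw [I.norm_sq_eq_sum]
    exact single_le_sum (f := fun p : ℕ × ℕ => ‖segment f p.1 p.2‖ ^ 2)
      (fun _ _ => sq_nonneg _) hp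
  by_cases hall : ∀ p ∈ I.parts, μ p = 0
  · have hff : f' = f := I.ext_segment fun p hp => by
      have := hdist p hp
      rw [hall p hp, zero_mul, norm_le_zero_iff, segment_sub, sub_eq_zero] at this
      exact this
    rcases eq_or_ne (deltaStar τ k β C N) 0 with h0 | h0
    · exact Or.inr ⟨h0, hff⟩
    · exact Or.inl (by simpa [hff] using pos_iff_ne_zero.2 h0)
  · push Not at hall
    obtain ⟨p₀, hp₀, hμp₀⟩ := hall
    refine Or.inl (lt_of_lt_of_le ?_ (le_iSup (deltaPartition τ k β C) I))
    have hlt : ∑ p ∈ I.parts, ‖segment (f' - f) p.1 p.2‖ ^ 2 < ∑ p ∈ I.parts, (μ p * C) ^ 2 := by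
      refine sum_lt_sum (fun p hp => ?_) ⟨p₀, hp₀, ?_⟩
      · exact pow_le_pow_left₀ (norm_nonneg _)
          ((hdist p hp).trans (mul_le_mul_of_nonneg_left (hsegC p hp).le (hμ0 p))) 2
      · exact pow_lt_pow_left₀ ((hdist p₀ hp₀).trans_lt
          (mul_lt_mul_of_pos_left (hsegC p₀ hp₀) ((hμ0 p₀).lt_of_ne' hμp₀)))
          (norm_nonneg _) two_ne_zero
    rw [← I.norm_sq_eq_sum] at hlt
    rw [deltaPartition_eq_ofReal hC.le fun p hp => backwardError_ne_top hC hδ I hp, ← ofReal_norm]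
    have h2 : ‖f' - f‖ < √(∑ p ∈ I.parts, (μ p * C) ^ 2) := Real.lt_sqrt_of_sq_lt hlt
    exact (ENNReal.ofReal_lt_ofReal_iff ((norm_nonneg _).trans_lt h2)).2 h2

end

end MumfordShah

theorem mainTheorem4 (N k : ℕ) (hk : 1 ≤ k) (β : ENNReal) (hβ : 0 < β) (γ : ℝ) (hγ : 0 < γ)
    (C : ℝ) (f : EuclideanSpace ℝ (Fin N)) (hf : ‖f‖ < C)
    (ε : ℝ) (hε : 0 < ε) (I' : IntervalPartition N)
    (hmargin : ∀ I : IntervalPartition N, ¬ IntervalPartition.Equivalent k I I' →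
      classEnergy k β γ f I' < classEnergy k β γ f I - ε)
    (τ : ℝ) (hτ : 0 ≤ τ) (hτ1 : τ < 1)
    (hδ : deltaStar τ k β C N < ENNReal.ofReal (stabilityRadius k β ε ‖f‖ / 2))
    (hg : energyErrorBound τ k β γ C N ≤ ENNReal.ofReal (ε / 4)) :
    (∃! u : EuclideanSpace ℝ (Fin N), IsMinimizer k β γ f u) ∧
    ∀ M : MachineArith τ, ∃ f' : EuclideanSpace ℝ (Fin N),
      (‖f' - f‖ₑ < deltaStar τ k β C N ∨ (deltaStar τ k β C N = 0 ∧ f' = f)) ∧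
      ∀ u : EuclideanSpace ℝ (Fin N),
        IsMinimizer k β γ f' u ↔ u = computedSignal M k β γ f := by
  constructor
  · obtain ⟨u, hu⟩ := exists_isPartitionFit k β f I'
    have h := isMinimizer_iff_of_classEnergy_lt hγ.le hu fun I hI => by
      have := hmargin I hI
      linarith
    exact ⟨u, (h u).2 rfl, fun w hw => (h w).1 hw⟩
  · intro M
    obtain ⟨hT, hTI⟩ := exists_tiles_computedSegments hk hγ.le hτ1.le hε hg M hf hmargin
    obtain ⟨f', hfit, hclose⟩ := exists_isPartitionFit_of_computedFit M hf hδ.ne_top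
      fun p hp => segment_computedSignal hT (hT.mem_toPartition.1 hp)
    refine ⟨f', hclose, isMinimizer_iff_of_classEnergy_lt hγ.le hfit fun I hI => ?_⟩
    have hrad : 0 < stabilityRadius k β ε ‖f‖ / 2 :=
      ENNReal.ofReal_pos.1 (pos_of_gt hδ)
    have hnorm : ‖f' - f‖ < stabilityRadius k β ε ‖f‖ / 2 := by
      rcases hclose with h | ⟨-, rfl⟩
      · have h' := h.trans hδ
        rw [← ofReal_norm] at h'
        exact (ENNReal.ofReal_lt_ofReal_iff hrad).1 h'
      · simpa using hrad
    rw [classEnergy_congr f' hTI]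
    exact classEnergy_lt_of_norm_sub_lt hβ (hmargin I fun h => hI (h.trans hTI.symm)) hnorm
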